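/- Let $\mathcal A=\{r,g\}$ and let $\mu_r,\mu_g$ be probability measures on $\mathbb Z^2$. Assume that there are $c>0$ with $\mathbb E_{\mu_a}\big(e^{c\|\xi\|}\big)<\infty$ for $a=r,g$, and a unit vector $l\in\mathbb R^2$ with $\min\{\langle d(\mu_r),l\rangle,\langle d(\mu_g),l\rangle\}>0$, where $d(\mu)=\mathbb E_\mu(\xi)\in\mathbb R^2$ and $\|\cdot\|$ is the Euclidean norm. Let $p(x+\xi\mid x,a)=\mu_a(\xi)$ for $x,\xi\in\mathbb Z^2$ and $a\in\mathcal A$. A decision rule $\varphi$ assigns to each $b\in\mathbb R^{\mathcal A}$ a probability measure $\varphi(\cdot\mid b)$ on $\mathcal A$; an update rule is a function $\psi:\mathbb R^{\mathcal A}\times\mathbb R^{\mathcal A}\times\mathbb Z^2\times\mathcal A\to\mathbb R$. A local learning process (LLP) for $p$ with a (deterministic or random) initial state $X_0$, a deterministic initial environment $\beta_0:\mathbb Z^2\times\mathcal A\to\mathbb R$, update rule $\psi$ and decision rule $\varphi$ is a stochastic process $(X_n,A_n,\beta_n)_{n\ge0}$ with $X_n\in\mathbb Z^2$, $A_n\in\mathcal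 A$, $\beta_n:\mathbb Z^2\times\mathcal A\to\mathbb R$, such that for all $n\ge 0$: 1. conditionally on $X_0,A_0,\dots,X_{n-1},A_{n-1},X_n$, the action $A_n$ has law $\varphi(\cdot\mid\beta_n(X_n,\cdot))$; 2. conditionally on $X_0,A_0,\dots,X_n,A_n$, the state $X_{n+1}$ has law $p(\cdot\mid X_n,A_n)$; 3. $\beta_{n+1}(X_n,A_n)=\psi\big(\beta_n(X_n,\cdot),\beta_n(X_{n+1},\cdot),X_{n+1}-X_n,A_n\big)$, and $\beta_{n+1}(x,a)=\beta_n(x,a)$ for $(x,a)\ne(X_n,A_n)$; and such that $\varphi(a\mid\beta_0(x,\cdot))>0$ for all $x\in\mathbb Z^2$, $a\in\mathcal A$, and $\beta_0(x,\cdot)=\beta_0(y,\cdot)$ for all $x,y\in\mathbb Z^2$. **Theorem.** For every such LLP there is a constant $\alpha\in\mathbb R$ such that, almost surely, $$\lim_{n\to\infty}\frac1n\sum_{i=1}^n\mathbf 1(A_i=r)=\alpha \qquad\text{and}\qquad \lim_{n\to\infty}\frac{X_n}{n}=\alpha\,d(\mu_r)+(1-\alpha)\,d(\mu_g).$$ 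-/

import Mathlib

open MeasureTheory ProbabilityTheory Filter Topology

namespace LocalLearning

/-- The two actions: red and green. -/
inductive Act where
  | r : Act
  | g : Act

/-- Every set of actions is measurable. -/
instance : MeasurableSpace Act := ⊤

/-- The grid `ℤ²`. -/
abbrev Grid := Fin 2 → ℤ

/-- The Euclidean plane `ℝ²`. -/
abbrev Plane := EuclideanSpace ℝ (Fin 2)

/-- The inclusion of `ℤ²` into `ℝ²`. -/
noncomputable def toPlane (x : Grid) : Plane := WithLp.toLp 2 (fun i => (x i : ℝ))

/-- The drift (mean) of a probability measure on `ℤ²`. -/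
noncomputable def drift (μ : PMF Grid) : Plane := ∫ ξ, toPlane ξ ∂μ.toMeasure

/-- The transition probabilities `p (· | x, a)` on `ℤ²` with two actions are translation invariant
with jump laws `μ a`, the jump laws have a finite exponential moment, and their drifts have
positive components in a common direction. -/
structure IsFreeModel (p : Grid → Act → PMF Grid) (μ : Act → PMF Grid) : Prop where
  transition : ∀ (x ξ : Grid) (a : Act), p x a (x + ξ) = μ a ξ
  exp_moment : ∃ c : ℝ, 0 < c ∧
    ∀ a : Act, Integrable (fun ξ : Grid => Real.exp (c * ‖toPlane ξ‖)) (μ a).toMeasure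
  common_direction : ∃ l : Plane, ‖l‖ = 1 ∧
    0 < min (inner ℝ (drift (μ Act.r)) l) (inner ℝ (drift (μ Act.g)) l)

/-- An environment: the information stored at each state-action pair. -/
abbrev Env := Grid → Act → ℝ

/-- The decision rule `φ (· | b)`: the law of the action as a function of the environment `b`
at the current state. -/
abbrev DecisionRule := (Act → ℝ) → PMF Act

/-- The update rule `ψ (b, b', ξ, a)`: the new value at the current state-action pair, given the
environments `b`, `b'` at the current and at the next state, the jump `ξ` and the action `a`. -/
abbrev UpdateRule := (Act → ℝ) → (Act → ℝ) → Grid → Act → ℝ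

variable {Ω : Type*}

/-- The σ-algebra generated by `X₀, A₀, …, Xₙ₋₁, Aₙ₋₁, Xₙ`. -/
@[reducible] def historyBeforeAction (X : ℕ → Ω → Grid) (A : ℕ → Ω → Act) (n : ℕ) : MeasurableSpace Ω :=
  (⨆ i : ℕ, ⨆ _ : i ≤ n, MeasurableSpace.comap (X i) inferInstance) ⊔
    (⨆ i : ℕ, ⨆ _ : i < n, MeasurableSpace.comap (A i) inferInstance)

/-- The σ-algebra generated by `X₀, A₀, …, Xₙ, Aₙ`. -/
@[reducible] def historyAfterAction (X : ℕ → Ω → Grid) (A : ℕ → Ω → Act) (n : ℕ) : MeasurableSpace Ω :=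
  (⨆ i : ℕ, ⨆ _ : i ≤ n, MeasurableSpace.comap (X i) inferInstance) ⊔
    (⨆ i : ℕ, ⨆ _ : i ≤ n, MeasurableSpace.comap (A i) inferInstance)

/-- `(Xₙ, Aₙ, βₙ)` is a local learning process for the transition probabilities `p`, with initial
environment `β₀`, update rule `ψ` and decision rule `φ`. The initial state `X 0` is arbitrary
(deterministic or random). -/
structure IsLLP [MeasurableSpace Ω] (P : Measure Ω) (p : Grid → Act → PMF Grid)
    (β₀ : Env) (ψ : UpdateRule) (φ : DecisionRule)
    (X : ℕ → Ω → Grid) (A : ℕ → Ω → Act) (β : ℕ → Ω → Env) : Prop where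
  measurable_state : ∀ n, Measurable (X n)
  measurable_action : ∀ n, Measurable (A n)
  /-- Given the past, `Aₙ` has law `φ (· | βₙ (Xₙ, ·))`. -/
  action_law : ∀ (n : ℕ) (a : Act),
    P[({ω | A n ω = a}).indicator (fun _ => (1 : ℝ)) | historyBeforeAction X A n]
      =ᵐ[P] fun ω => (φ (β n ω (X n ω)) a).toReal
  /-- Given the past, `Xₙ₊₁` has law `p (· | Xₙ, Aₙ)`. -/
  state_law : ∀ (n : ℕ) (y : Grid),
    P[({ω | X (n + 1) ω = y}).indicator (fun _ => (1 : ℝ)) | historyAfterAction X A n]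
      =ᵐ[P] fun ω => (p (X n ω) (A n ω) y).toReal
  env_zero : ∀ ω, β 0 ω = β₀
  env_update : ∀ (n : ℕ) (ω : Ω), β (n + 1) ω (X n ω) (A n ω) =
    ψ (β n ω (X n ω)) (β n ω (X (n + 1) ω)) (X (n + 1) ω - X n ω) (A n ω)
  env_keep : ∀ (n : ℕ) (ω : Ω) (x : Grid) (a : Act), (x, a) ≠ (X n ω, A n ω) →
    β (n + 1) ω x a = β n ω x a
  /-- Every action has positive probability at the first visit to any state. -/
  first_visit_pos : ∀ (x : Grid) (a : Act), 0 < φ (β₀ x) a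
  /-- The initial environment is state invariant. -/
  env_invariant : ∀ x y : Grid, β₀ x = β₀ y

end LocalLearning

/-! The proof is a regeneration argument in the direction `l`. Let `Q` be the law of the sequence of
steps (action, jump), and let the height of a path be the component of its displacement along `l`.
At a strict record of the height, no site at or above the current level has been visited before, so
the environment there is still the initial one, which is the same at all sites. Until the path
undershoots the record, its further steps therefore have the law of a process started afresh
(`pathEnv_add`, `renewsAtRecords`).

A regeneration is a record that is never undershot. Conditionally on never going below the starting
level, the path from the first regeneration on has the same conditional law as the whole path and is
independent of the block sums before it (`RenewsAtRecords.cond_inter`). The block sums are then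
identically distributed and pairwise independent, which suffices for the strong law. It remains to
see that blocks have finite mean length. The events that `m` is the last regeneration up to time `n`
are disjoint, so the sums of `P(record at m) * P(stay nonnegative, no regeneration up to n - m)`
over `m ≤ n` are at most one. As the expected number of records grows linearly, the second factors
are summable (`summable_of_renewal`), and they bound the tails of the block length.

Since infinitely many records occur and each is a regeneration with a fixed positive probability, a
regeneration exists almost surely (`RenewsAtRecords.ae_exists_regen`). Averages ignore the path
before it, so the limit holds without the conditioning.

The probabilistic inputs all come from one exponential estimate: if every conditional exponential
moment of `f` is at most `ρ < 1`, then the partial sums of `f` are nonnegative at time `n` with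
probability at most `ρ ^ n`. It yields linear growth of the height, the density of records, a
positive probability of never going below the start, and the law of large numbers for the jumps
centred by their drifts, which turns the frequency of red actions into a velocity. -/

namespace LocalLearning

/-! ### Path space, events decided by finitely many steps, and renewal at records. -/

section PathSpace

set_option linter.unusedSectionVars false

variable {E : Type*}

/-- The height reached after `n` steps, when the step `e` has height `h e`. -/
def height (h : E → ℝ) (n : ℕ) (ω : ℕ → E) : ℝ := ∑ i ∈ Finset.range n, h (ω i)

/-- The path from time `n` on. -/
def shift (n : ℕ) (ω : ℕ → E) : ℕ → E := fun i => ω (n + i)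

/-- The paths whose height at time `n` exceeds all earlier heights. -/
def recordSet (h : E → ℝ) (n : ℕ) : Set (ℕ → E) := {ω | ∀ m < n, height h m ω < height h n ω}

/-- The paths whose heights up to time `n` are nonnegative. -/
def staySet (h : E → ℝ) (n : ℕ) : Set (ℕ → E) := {ω | ∀ m ≤ n, 0 ≤ height h m ω}

/-- The paths all whose heights are nonnegative. -/
def stayForever (h : E → ℝ) : Set (ℕ → E) := {ω | ∀ m, 0 ≤ height h m ω}

/-- The paths with a regeneration at time `n`: a record height, never undershot afterwards. -/
def regenSet (h : E → ℝ) (n : ℕ) : Set (ℕ → E) := recordSet h n ∩ shift n ⁻¹' stayForever h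

/-- Whether a path belongs to `A` is decided by its first `n` steps. -/
def IsPrefixEvent (n : ℕ) (A : Set (ℕ → E)) : Prop := ∀ ω ∈ A, PiNat.cylinder ω n ⊆ A

theorem height_add (h : E → ℝ) (n m : ℕ) (ω : ℕ → E) :
    height h (n + m) ω = height h n ω + height h m (shift n ω) := by
  simp [height, shift, Finset.sum_range_add]

@[simp] theorem height_zero (h : E → ℝ) (ω : ℕ → E) : height h 0 ω = 0 := by simp [height]

theorem height_succ (h : E → ℝ) (n : ℕ) (ω : ℕ → E) :
    height h (n + 1) ω = height h n ω + h (ω n) := by simp [height, Finset.sum_range_succ]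

@[simp] theorem shift_zero (ω : ℕ → E) : shift 0 ω = ω := by ext; simp [shift]

theorem shift_shift (n m : ℕ) (ω : ℕ → E) : shift m (shift n ω) = shift (n + m) ω := by
  ext; simp [shift, add_assoc]

theorem height_congr {h : E → ℝ} {n m : ℕ} {ω η : ℕ → E} (hη : η ∈ PiNat.cylinder ω n)
    (hm : m ≤ n) : height h m η = height h m ω := by
  rw [PiNat.mem_cylinder_iff] at hη
  exact Finset.sum_congr rfl fun i hi => by rw [hη i ((Finset.mem_range.1 hi).trans_le hm)]

theorem IsPrefixEvent.mono {n m : ℕ} {A : Set (ℕ → E)} (hA : IsPrefixEvent n A) (hnm : n ≤ m) :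
    IsPrefixEvent m A := fun ω hω => (PiNat.cylinder_anti ω hnm).trans (hA ω hω)

theorem IsPrefixEvent.inter {n : ℕ} {A B : Set (ℕ → E)} (hA : IsPrefixEvent n A)
    (hB : IsPrefixEvent n B) : IsPrefixEvent n (A ∩ B) :=
  fun ω hω => Set.subset_inter (hA ω hω.1) (hB ω hω.2)

theorem IsPrefixEvent.union {n : ℕ} {A B : Set (ℕ → E)} (hA : IsPrefixEvent n A)
    (hB : IsPrefixEvent n B) : IsPrefixEvent n (A ∪ B) := by
  rintro ω (hω | hω)
  · exact (hA ω hω).trans Set.subset_union_left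
  · exact (hB ω hω).trans Set.subset_union_right

theorem IsPrefixEvent.compl {n : ℕ} {A : Set (ℕ → E)} (hA : IsPrefixEvent n A) :
    IsPrefixEvent n Aᶜ :=
  fun _ hω η hη hηA => hω (hA η hηA ((PiNat.mem_cylinder_comm _ _ _).1 hη))

theorem isPrefixEvent_cylinder (ω : ℕ → E) (n : ℕ) : IsPrefixEvent n (PiNat.cylinder ω n) :=
  fun η hη => by rw [PiNat.mem_cylinder_iff_eq.1 hη]

theorem isPrefixEvent_recordSet (h : E → ℝ) (n : ℕ) : IsPrefixEvent n (recordSet h n) := by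
  intro ω hω η hη m hm
  rw [height_congr hη hm.le, height_congr hη le_rfl]
  exact hω m hm

theorem isPrefixEvent_staySet (h : E → ℝ) (n : ℕ) : IsPrefixEvent n (staySet h n) := by
  intro ω hω η hη m hm
  rw [height_congr hη hm]
  exact hω m hm

theorem stayForever_eq_iInter (h : E → ℝ) : stayForever h = ⋂ n, staySet h n := by
  ext ω
  simp only [stayForever, staySet, Set.mem_ofPred_eq, Set.mem_iInter]
  exact ⟨fun H n m _ => H m, fun H m => H m m le_rfl⟩

theorem antitone_staySet (h : E → ℝ) : Antitone (staySet h) :=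
  fun _ _ hnm _ hω m hm => hω m (hm.trans hnm)

/-- The path that follows `ω` for `n` steps and `η` afterwards. -/
def splice (n : ℕ) (ω η : ℕ → E) : ℕ → E := fun i => if i < n then ω i else η (i - n)

@[simp] theorem shift_splice (n : ℕ) (ω η : ℕ → E) : shift n (splice n ω η) = η := by
  ext; simp [shift, splice]

theorem splice_mem_cylinder (n : ℕ) (ω η : ℕ → E) : splice n ω η ∈ PiNat.cylinder ω n := by
  rw [PiNat.mem_cylinder_iff]
  intro i hi
  simp [splice, hi]

theorem cylinder_add (n m : ℕ) (ω : ℕ → E) : PiNat.cylinder ω (n + m) =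
    PiNat.cylinder ω n ∩ shift n ⁻¹' PiNat.cylinder (shift n ω) m := by
  ext η
  simp only [PiNat.mem_cylinder_iff, Set.mem_inter_iff, Set.mem_preimage, shift]
  refine ⟨fun H => ⟨fun i hi => H i (by omega), fun i hi => H _ (by omega)⟩, fun H i hi => ?_⟩
  by_cases hin : i < n
  · exact H.1 i hin
  · obtain ⟨k, rfl⟩ := Nat.exists_eq_add_of_le (not_lt.1 hin)
    exact H.2 k (by omega)

theorem cylinder_splice (n m : ℕ) (ω η : ℕ → E) : PiNat.cylinder (splice n ω η) (n + m) =
    PiNat.cylinder ω n ∩ shift n ⁻¹' PiNat.cylinder η m := by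
  rw [cylinder_add, shift_splice, PiNat.mem_cylinder_iff_eq.1 (splice_mem_cylinder n ω η)]

variable [MeasurableSpace E]

theorem measurable_shift (n : ℕ) : Measurable (shift n : (ℕ → E) → ℕ → E) :=
  measurable_pi_lambda _ fun i => measurable_pi_apply (n + i)

/-- The first `n` steps of a path. -/
def firstSteps (n : ℕ) (ω : ℕ → E) : Fin n → E := fun i => ω i

theorem measurable_firstSteps (n : ℕ) : Measurable (firstSteps n : (ℕ → E) → Fin n → E) :=
  measurable_pi_lambda _ fun i => measurable_pi_apply (i : ℕ)

theorem firstSteps_eq_iff {n : ℕ} {ω η : ℕ → E} :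
    firstSteps n η = firstSteps n ω ↔ η ∈ PiNat.cylinder ω n := by
  rw [PiNat.mem_cylinder_iff, funext_iff]
  exact ⟨fun H i hi => H ⟨i, hi⟩, fun H i => H i i.2⟩

theorem firstSteps_preimage_singleton (n : ℕ) (ω : ℕ → E) :
    firstSteps n ⁻¹' {firstSteps n ω} = PiNat.cylinder ω n := by
  ext η
  exact firstSteps_eq_iff

theorem IsPrefixEvent.preimage_image {n : ℕ} {A : Set (ℕ → E)} (hA : IsPrefixEvent n A) :
    firstSteps n ⁻¹' (firstSteps n '' A) = A := by
  refine subset_antisymm ?_ (Set.subset_preimage_image _ _)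
  rintro ω ⟨η, hη, he⟩
  exact hA η hη (firstSteps_eq_iff.1 he.symm)

variable [Countable E] [MeasurableSingletonClass E]

theorem IsPrefixEvent.measurableSet {n : ℕ} {A : Set (ℕ → E)} (hA : IsPrefixEvent n A) :
    MeasurableSet A := by
  rw [← hA.preimage_image]
  exact measurable_firstSteps n (Set.to_countable _).measurableSet

theorem measurableSet_stayForever (h : E → ℝ) : MeasurableSet (stayForever h) := by
  rw [stayForever_eq_iInter]
  exact MeasurableSet.iInter fun n => (isPrefixEvent_staySet h n).measurableSet

theorem measurableSet_regenSet (h : E → ℝ) (n : ℕ) : MeasurableSet (regenSet h n) :=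
  (isPrefixEvent_recordSet h n).measurableSet.inter
    (measurable_shift n (measurableSet_stayForever h))

/-- Two measures that compare on cylinders of length `n` compare on events of length `n`. -/
theorem IsPrefixEvent.measure_le {n : ℕ} {A : Set (ℕ → E)} (hA : IsPrefixEvent n A)
    {μ ν : Measure (ℕ → E)} (H : ∀ ω ∈ A, μ (PiNat.cylinder ω n) ≤ ν (PiNat.cylinder ω n)) :
    μ A ≤ ν A := by
  have key : ∀ ρ : Measure (ℕ → E),
      ρ A = ∑' x : firstSteps n '' A, ρ (firstSteps n ⁻¹' {(x : Fin n → E)}) := by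
    intro ρ
    rw [tsum_measure_preimage_singleton (Set.to_countable _)
      fun x _ => measurable_firstSteps n (measurableSet_singleton x), hA.preimage_image]
  rw [key μ, key ν]
  refine ENNReal.tsum_le_tsum ?_
  rintro ⟨_, ω, hω, rfl⟩
  simpa only [firstSteps_preimage_singleton] using H ω hω

theorem IsPrefixEvent.measure_eq {n : ℕ} {A : Set (ℕ → E)} (hA : IsPrefixEvent n A)
    {μ ν : Measure (ℕ → E)} (H : ∀ ω ∈ A, μ (PiNat.cylinder ω n) = ν (PiNat.cylinder ω n)) :
    μ A = ν A :=
  le_antisymm (hA.measure_le fun ω hω => (H ω hω).le) (hA.measure_le fun ω hω => (H ω hω).ge)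

/-- The events decided by finitely many steps form an algebra. -/
theorem isSetAlgebra_prefixEvents :
    IsSetAlgebra {A : Set (ℕ → E) | ∃ n, IsPrefixEvent n A} where
  empty_mem := ⟨0, fun _ hω => hω.elim⟩
  compl_mem := fun _ ⟨n, hA⟩ => ⟨n, hA.compl⟩
  union_mem := fun _ _ ⟨n, hA⟩ ⟨m, hB⟩ =>
    ⟨max n m, (hA.mono (le_max_left _ _)).union (hB.mono (le_max_right _ _))⟩

theorem generateFrom_prefixEvents :
    (MeasurableSpace.pi : MeasurableSpace (ℕ → E)) =
      MeasurableSpace.generateFrom {A : Set (ℕ → E) | ∃ n, IsPrefixEvent n A} := by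
  refine le_antisymm ?_ (MeasurableSpace.generateFrom_le fun A ⟨n, hA⟩ => hA.measurableSet)
  refine iSup_le fun i => ?_
  rintro _ ⟨s, -, rfl⟩
  refine MeasurableSpace.measurableSet_generateFrom ⟨i + 1, fun ω hω η hη => ?_⟩
  rw [PiNat.mem_cylinder_iff] at hη
  simpa [hη i (Nat.lt_succ_self i)] using hω

/-- The law of a path is renewed at record heights: steps after a record, as long as they do not
undershoot it, have the same law as steps from the start. -/
def RenewsAtRecords (h : E → ℝ) (Q : Measure (ℕ → E)) : Prop :=
  ∀ (n m : ℕ) (ω : ℕ → E), ω ∈ recordSet h n → shift n ω ∈ staySet h m →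
    Q (PiNat.cylinder ω (n + m)) = Q (PiNat.cylinder ω n) * Q (PiNat.cylinder (shift n ω) m)

variable {h : E → ℝ} {Q : Measure (ℕ → E)} [IsProbabilityMeasure Q]

/-- Both sides are measures evaluated at `C`, so cylinders suffice. For these, the renewal property
is applied to the path that follows `ω` up to time `n` and a point of `C` afterwards. -/
theorem RenewsAtRecords.cylinder_inter_prefix (hQ : RenewsAtRecords h Q) {n m : ℕ} {ω : ℕ → E}
    (hω : ω ∈ recordSet h n) {C : Set (ℕ → E)} (hC : IsPrefixEvent m C) (hCm : C ⊆ staySet h m) :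
    Q (PiNat.cylinder ω n ∩ shift n ⁻¹' C) = Q (PiNat.cylinder ω n) * Q C := by
  have := hC.measure_eq (μ := (Q.restrict (PiNat.cylinder ω n)).map (shift n))
    (ν := Q (PiNat.cylinder ω n) • Q) (fun η hη => ?_)
  · rwa [Measure.map_apply (measurable_shift n) hC.measurableSet,
      Measure.restrict_apply (measurable_shift n hC.measurableSet), Set.inter_comm,
      Measure.smul_apply, smul_eq_mul] at this
  · have hm := (isPrefixEvent_cylinder η m).measurableSet
    rw [Measure.map_apply (measurable_shift n) hm, Measure.restrict_apply (measurable_shift n hm),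
      Set.inter_comm, ← cylinder_splice, hQ n m, shift_splice,
      PiNat.mem_cylinder_iff_eq.1 (splice_mem_cylinder n ω η), Measure.smul_apply, smul_eq_mul]
    · exact isPrefixEvent_recordSet h n ω hω (splice_mem_cylinder n ω η)
    · simpa using hCm hη

/-- Staying nonnegative forever is not decided in finite time, but it is the decreasing limit of the
sets `staySet h k`. The two measures restricted to `stayForever h` thus agree on prefix events,
which form a generating π-system. -/
theorem RenewsAtRecords.cylinder_inter (hQ : RenewsAtRecords h Q) {n : ℕ} {ω : ℕ → E}
    (hω : ω ∈ recordSet h n) {B : Set (ℕ → E)} (hB : MeasurableSet B) (hBs : B ⊆ stayForever h) :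
    Q (PiNat.cylinder ω n ∩ shift n ⁻¹' B) = Q (PiNat.cylinder ω n) * Q B := by
  set μ := ((Q.restrict (PiNat.cylinder ω n)).map (shift n)).restrict (stayForever h) with hμ
  set ν := (Q (PiNat.cylinder ω n) • Q).restrict (stayForever h) with hν
  have hs := measurableSet_stayForever h
  have key : ∀ C, (∃ m, IsPrefixEvent m C) → μ C = ν C := by
    rintro C ⟨m, hC⟩
    have hlim : ∀ ρ : Measure (ℕ → E), IsFiniteMeasure ρ → Tendsto (fun k => ρ (C ∩ staySet h k))
        atTop (𝓝 (ρ.restrict (stayForever h) C)) := by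
      intro ρ _
      rw [Measure.restrict_apply hC.measurableSet, stayForever_eq_iInter, Set.inter_iInter]
      refine tendsto_measure_iInter_atTop
        (fun k => (hC.measurableSet.inter (isPrefixEvent_staySet h k).measurableSet).nullMeasurableSet)
        (fun a b hab => Set.inter_subset_inter_right _ (antitone_staySet h hab))
        ⟨0, measure_ne_top _ _⟩
    refine tendsto_nhds_unique_of_eventuallyEq (hlim _ inferInstance)
      (hlim _ (Measure.smul_finite _ (measure_ne_top _ _))) ?_
    filter_upwards [eventually_ge_atTop m] with k hk
    have hCk : IsPrefixEvent k (C ∩ staySet h k) := (hC.mono hk).inter (isPrefixEvent_staySet h k)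
    rw [Measure.map_apply (measurable_shift n) hCk.measurableSet,
      Measure.restrict_apply (measurable_shift n hCk.measurableSet), Set.inter_comm,
      hQ.cylinder_inter_prefix hω hCk Set.inter_subset_right, Measure.smul_apply, smul_eq_mul]
  have heq : μ = ν := by
    have : IsFiniteMeasure (Q (PiNat.cylinder ω n) • Q) :=
      Measure.smul_finite _ (measure_ne_top _ _)
    refine ext_of_generate_finite _ generateFrom_prefixEvents ?_ key
      (key _ ⟨0, fun _ _ => Set.subset_univ _⟩)
    exact fun s hs t ht _ => isSetAlgebra_prefixEvents.inter_mem hs ht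
  have := congrArg (fun ρ => ρ B) heq
  simp only [hμ, hν] at this
  rwa [Measure.restrict_apply hB, Measure.restrict_apply hB, Set.inter_eq_self_of_subset_left hBs,
    Measure.map_apply (measurable_shift n) hB, Measure.restrict_apply (measurable_shift n hB),
    Set.inter_comm, Measure.smul_apply, smul_eq_mul] at this

/-- The path after a record, provided that it never undershoots the record, is independent of the
path before. -/
theorem RenewsAtRecords.inter_shift (hQ : RenewsAtRecords h Q) {n : ℕ} {A B : Set (ℕ → E)}
    (hA : IsPrefixEvent n A) (hAr : A ⊆ recordSet h n)
    (hB : MeasurableSet B) (hBs : B ⊆ stayForever h) :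
    Q (A ∩ shift n ⁻¹' B) = Q A * Q B := by
  have := hA.measure_eq (μ := Q.restrict (shift n ⁻¹' B)) (ν := Q B • Q) (fun ω hω => ?_)
  · rwa [Measure.restrict_apply hA.measurableSet, Measure.smul_apply, smul_eq_mul, mul_comm] at this
  · rw [Measure.restrict_apply (isPrefixEvent_cylinder ω n).measurableSet,
      hQ.cylinder_inter (hAr hω) hB hBs, Measure.smul_apply, smul_eq_mul, mul_comm]

end PathSpace

/-! ### The first regeneration and the block before it. -/

section Regeneration

set_option linter.unusedSectionVars false

/-- If `∑ a m * b (n - m)` is bounded and the partial sums of `a` grow linearly, then `b` is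
summable. -/
theorem summable_of_renewal {a b : ℕ → ℝ} (ha : ∀ n, 0 ≤ a n) (hb : ∀ n, 0 ≤ b n)
    (hab : ∀ n, ∑ m ∈ Finset.range (n + 1), a m * b (n - m) ≤ 1) {c : ℝ} (hc : 0 < c)
    (hd : ∀ᶠ n : ℕ in atTop, c * n ≤ ∑ m ∈ Finset.range n, a m) : Summable b := by
  refine summable_of_sum_range_le (c := 2 / c) hb fun n => ?_
  -- The linear growth holds only for large indices, so the partial sum of `b` is enlarged to such
  -- an `N`. The square of side `N` lies in the triangle of side `2 * N`, each of whose diagonals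
  -- contributes at most `1`.
  obtain ⟨N, hN, hnN, hN0⟩ := (hd.and ((eventually_ge_atTop n).and (eventually_gt_atTop 0))).exists
  have hN0' : (0 : ℝ) < N := by exact_mod_cast hN0
  have hbn : ∑ k ∈ Finset.range n, b k ≤ ∑ k ∈ Finset.range N, b k :=
    Finset.sum_le_sum_of_subset_of_nonneg (Finset.range_subset_range.2 hnN) fun i _ _ => hb i
  have h1 : (∑ m ∈ Finset.range N, a m) * ∑ k ∈ Finset.range N, b k ≤ 2 * N := by
    calc (∑ m ∈ Finset.range N, a m) * ∑ k ∈ Finset.range N, b k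
        = ∑ m ∈ Finset.range N, ∑ k ∈ Finset.range N, a m * b k := Finset.sum_mul_sum ..
      _ ≤ ∑ m ∈ Finset.range N, ∑ k ∈ Finset.range (2 * N - m), a m * b k := by
          refine Finset.sum_le_sum fun m hm => ?_
          rw [Finset.mem_range] at hm
          exact Finset.sum_le_sum_of_subset_of_nonneg (Finset.range_subset_range.2 (by omega))
            fun i _ _ => mul_nonneg (ha m) (hb i)
      _ ≤ ∑ m ∈ Finset.range (2 * N), ∑ k ∈ Finset.range (2 * N - m), a m * b k :=
          Finset.sum_le_sum_of_subset_of_nonneg (Finset.range_subset_range.2 (by omega))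
            fun i _ _ => Finset.sum_nonneg fun k _ => mul_nonneg (ha i) (hb k)
      _ = ∑ m ∈ Finset.range (2 * N), ∑ k ∈ Finset.range (m + 1), a k * b (m - k) :=
          (Finset.sum_range_diag_flip (2 * N) fun m k => a m * b k).symm
      _ ≤ ∑ m ∈ Finset.range (2 * N), (1 : ℝ) := Finset.sum_le_sum fun m _ => hab m
      _ = 2 * N := by simp
  have h2 : c * N * ∑ k ∈ Finset.range N, b k ≤ 2 * N :=
    (mul_le_mul_of_nonneg_right hN (Finset.sum_nonneg fun k _ => hb k)).trans h1
  have h3 : c * ∑ k ∈ Finset.range N, b k ≤ 2 := by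
    refine le_of_mul_le_mul_right ?_ hN0'
    linarith
  rw [le_div_iff₀ hc]
  nlinarith

variable {E : Type*}

/-- The first regeneration after time `0` (and `0` if there is none). -/
noncomputable def firstRegen (h : E → ℝ) (ω : ℕ → E) : ℕ := sInf {n | 1 ≤ n ∧ ω ∈ regenSet h n}

/-- The paths without regeneration at the times `1, …, n`. -/
def noRegenSet (h : E → ℝ) (n : ℕ) : Set (ℕ → E) := {ω | ∀ m, 1 ≤ m → m ≤ n → ω ∉ regenSet h m}

/-- The paths whose first `n` steps can precede the first regeneration of a path staying
nonnegative. -/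
def blockSet (h : E → ℝ) (n : ℕ) : Set (ℕ → E) :=
  {ω | ω ∈ recordSet h n ∧ ω ∈ staySet h n ∧ ∀ m, 1 ≤ m → m < n → ω ∈ recordSet h m →
    ∃ k, m < k ∧ k ≤ n ∧ height h k ω < height h m ω}

/-- The path from the first regeneration on. -/
noncomputable def nextPath (h : E → ℝ) (ω : ℕ → E) : ℕ → E := shift (firstRegen h ω) ω

/-- The sum of `f` over the steps before the first regeneration. -/
noncomputable def blockSum (h f : E → ℝ) (ω : ℕ → E) : ℝ := height f (firstRegen h ω) ω

variable {h : E → ℝ}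

theorem isPrefixEvent_blockSet (n : ℕ) : IsPrefixEvent n (blockSet h n) := by
  rintro ω ⟨h1, h2, h3⟩ η hη
  refine ⟨isPrefixEvent_recordSet h n ω h1 hη, isPrefixEvent_staySet h n ω h2 hη,
    fun m hm hmn hr => ?_⟩
  have hr' : ω ∈ recordSet h m :=
    ((isPrefixEvent_recordSet h m).mono hmn.le) η hr ((PiNat.mem_cylinder_comm _ _ _).1 hη)
  obtain ⟨k, hmk, hkn, hk⟩ := h3 m hm hmn hr'
  exact ⟨k, hmk, hkn, by rwa [height_congr hη hkn, height_congr hη hmn.le]⟩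

/-- The bound `1 ≤ n` excludes the default value `sInf ∅ = 0`. -/
theorem firstRegen_eq_iff {ω : ℕ → E} {n : ℕ} (hn : 1 ≤ n) : firstRegen h ω = n ↔
    ω ∈ regenSet h n ∧ ∀ m, 1 ≤ m → m < n → ω ∉ regenSet h m := by
  constructor
  · rintro rfl
    have hne : {n | 1 ≤ n ∧ ω ∈ regenSet h n}.Nonempty :=
      Nat.nonempty_of_pos_sInf hn
    exact ⟨(Nat.sInf_mem hne).2, fun m hm hlt hr => Nat.notMem_of_lt_sInf hlt ⟨hm, hr⟩⟩
  · rintro ⟨hr, hlt⟩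
    refine le_antisymm (Nat.sInf_le ⟨hn, hr⟩) ?_
    have hmem := Nat.sInf_mem (s := {n | 1 ≤ n ∧ ω ∈ regenSet h n}) ⟨n, hn, hr⟩
    by_contra! hc
    exact hlt _ hmem.1 hc hmem.2

/-- This separates past from future. If the path regenerates at `n`, it stays from then on above
every earlier height, so a record before `n` fails to be a regeneration exactly when it is undershot
by time `n`. Hence being the first regeneration depends on the first `n` steps, apart from the
future staying above level `n`'s height. -/
theorem stayForever_inter_firstRegen {n : ℕ} (hn : 1 ≤ n) :
    stayForever h ∩ {ω | firstRegen h ω = n} = blockSet h n ∩ shift n ⁻¹' stayForever h := by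
  ext ω
  simp only [Set.mem_inter_iff, Set.mem_ofPred_eq, firstRegen_eq_iff hn, Set.mem_preimage]
  constructor
  · rintro ⟨hs, ⟨hr, hf⟩, hno⟩
    refine ⟨⟨hr, fun m _ => hs m, fun m hm hmn hrm => ?_⟩, hf⟩
    have hns : shift m ω ∉ stayForever h := fun hs' => hno m hm hmn ⟨hrm, hs'⟩
    simp only [stayForever, Set.mem_ofPred_eq, not_forall, not_le] at hns
    obtain ⟨k, hk⟩ := hns
    have hadd := height_add h m k ω
    have hk0 : k ≠ 0 := by rintro rfl; simp at hk
    refine ⟨m + k, by omega, ?_, by linarith⟩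
    by_contra! hc
    obtain ⟨j, hj⟩ := Nat.exists_eq_add_of_lt hc
    have h1 := height_add h n (j + 1) ω
    have h2 := hf (j + 1)
    have h3 := hr m hmn
    rw [hj] at hadd
    rw [← add_assoc] at h1
    linarith
  · rintro ⟨⟨hr, hs, hb⟩, hf⟩
    refine ⟨fun m => ?_, ⟨hr, hf⟩, fun m hm hmn hrm => ?_⟩
    · rcases le_total m n with hmn | hmn
      · exact hs m hmn
      · obtain ⟨k, rfl⟩ := Nat.exists_eq_add_of_le hmn
        rw [height_add]
        exact add_nonneg (hs n le_rfl) (hf k)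
    · obtain ⟨k, hmk, -, hk⟩ := hb m hm hmn hrm.1
      obtain ⟨j, rfl⟩ := Nat.exists_eq_add_of_le hmk.le
      have := hrm.2 j
      rw [height_add] at hk
      linarith

theorem shift_mem_recordSet {n m : ℕ} {ω : ℕ → E} (hω : ω ∈ recordSet h (n + m)) :
    shift n ω ∈ recordSet h m := by
  intro k hk
  have := hω (n + k) (by omega)
  rw [height_add, height_add] at this
  linarith

theorem shift_mem_regenSet {n m : ℕ} {ω : ℕ → E} (hω : ω ∈ regenSet h (n + m)) :
    shift n ω ∈ regenSet h m :=
  ⟨shift_mem_recordSet hω.1, by simpa only [Set.mem_preimage, shift_shift] using hω.2⟩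

variable [MeasurableSpace E] [Countable E] [MeasurableSingletonClass E]

theorem measurableSet_noRegenSet (n : ℕ) : MeasurableSet (noRegenSet h n) := by
  have : noRegenSet h n = ⋂ m, ⋂ (_ : 1 ≤ m), ⋂ (_ : m ≤ n), (regenSet h m)ᶜ := by
    ext; simp [noRegenSet]
  rw [this]
  exact MeasurableSet.iInter fun m => MeasurableSet.iInter fun _ => MeasurableSet.iInter fun _ =>
    (measurableSet_regenSet h m).compl

theorem measurable_firstRegen : Measurable (firstRegen h : (ℕ → E) → ℕ) := by
  have hpos : ∀ n, 1 ≤ n → MeasurableSet (firstRegen h ⁻¹' {n}) := by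
    intro n hn
    have : firstRegen h ⁻¹' {n} = regenSet h n ∩ noRegenSet h (n - 1) := by
      ext ω
      simp only [Set.mem_preimage, Set.mem_singleton_iff, firstRegen_eq_iff hn, Set.mem_inter_iff,
        noRegenSet, Set.mem_ofPred_eq]
      exact and_congr_right fun _ => forall_congr' fun m => forall_congr' fun _ =>
        ⟨fun H hm => H (by omega), fun H hm => H (by omega)⟩
    rw [this]
    exact (measurableSet_regenSet h n).inter (measurableSet_noRegenSet _)
  refine measurable_to_countable' fun n => ?_
  rcases Nat.eq_zero_or_pos n with rfl | hn
  · have : firstRegen h ⁻¹' {0} = (⋃ n, firstRegen h ⁻¹' {n + 1})ᶜ := by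
      ext ω
      simp only [Set.mem_preimage, Set.mem_singleton_iff, Set.mem_compl_iff, Set.mem_iUnion,
        not_exists]
      refine ⟨fun H n => by omega, fun H => ?_⟩
      by_contra hc
      exact H (firstRegen h ω - 1) (by omega)
    rw [this]
    exact (MeasurableSet.iUnion fun n => hpos _ (by omega)).compl
  · exact hpos n hn

theorem measurable_height (f : E → ℝ) (n : ℕ) : Measurable (height f n) :=
  Finset.measurable_sum _ fun i _ => (measurable_of_countable f).comp (measurable_pi_apply i)

theorem measurable_nextPath : Measurable (nextPath h : (ℕ → E) → ℕ → E) := by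
  have : Measurable fun q : ℕ × (ℕ → E) => shift q.1 q.2 :=
    measurable_from_prod_countable_right fun n => measurable_shift n
  exact this.comp (measurable_firstRegen.prodMk measurable_id)

theorem measurable_blockSum (f : E → ℝ) : Measurable (blockSum h f) := by
  have : Measurable fun q : ℕ × (ℕ → E) => height f q.1 q.2 :=
    measurable_from_prod_countable_right fun n => measurable_height f n
  exact this.comp (measurable_firstRegen.prodMk measurable_id)

variable {Q : Measure (ℕ → E)} [IsProbabilityMeasure Q]

/-- By renewal at records, the `m`-th term is the probability of a regeneration at `m` after which
none is seen from the new start up to time `n`. For two different `m` these events are disjoint,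
since the later regeneration would also be one for the path shifted to the earlier. -/
theorem RenewsAtRecords.sum_le_one (hQ : RenewsAtRecords h Q) (n : ℕ) :
    ∑ m ∈ Finset.range (n + 1),
      Q.real (recordSet h m) * Q.real (stayForever h ∩ noRegenSet h (n - m)) ≤ 1 := by
  have hB : ∀ j, MeasurableSet (stayForever h ∩ noRegenSet h j) := fun j =>
    (measurableSet_stayForever h).inter (measurableSet_noRegenSet j)
  set U : ℕ → Set (ℕ → E) := fun m =>
    recordSet h m ∩ shift m ⁻¹' (stayForever h ∩ noRegenSet h (n - m)) with hU
  have hmeas : ∀ m, MeasurableSet (U m) := fun m =>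
    (isPrefixEvent_recordSet h m).measurableSet.inter (measurable_shift m (hB _))
  have hlt : ∀ i j, i < j → j ≤ n → Disjoint (U i) (U j) := by
    intro i j hij hj
    rw [Set.disjoint_left]
    rintro ω ⟨-, -, hno⟩ ⟨hr, hs, -⟩
    obtain ⟨k, rfl⟩ := Nat.exists_eq_add_of_lt hij
    exact hno (k + 1) (by omega) (by omega) (shift_mem_regenSet ⟨hr, hs⟩)
  have hterm : ∀ m, Q.real (recordSet h m) * Q.real (stayForever h ∩ noRegenSet h (n - m)) =
      Q.real (U m) := by
    intro m
    rw [measureReal_def, measureReal_def, measureReal_def, ← ENNReal.toReal_mul,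
      hQ.inter_shift (isPrefixEvent_recordSet h m) subset_rfl (hB _) Set.inter_subset_left]
  simp only [hterm]
  rw [← measureReal_biUnion_finset _ fun m _ => hmeas m]
  · exact measureReal_le_one
  · intro i hi j hj hij
    simp only [Finset.coe_range, Set.mem_Iio] at hi hj
    rcases lt_or_gt_of_ne hij with hlt' | hlt'
    · exact hlt i j hlt' (by omega)
    · exact (hlt j i hlt' (by omega)).symm

/-- The law of the next path, jointly with the block before it. -/
theorem RenewsAtRecords.measure_block (hQ : RenewsAtRecords h Q) (f : E → ℝ) {U : Set ℝ}
    {B : Set (ℕ → E)} (hB : MeasurableSet B) :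
    Q (stayForever h ∩ {ω | firstRegen h ω ≠ 0} ∩ (blockSum h f ⁻¹' U ∩ nextPath h ⁻¹' B)) =
      (∑' n, Q (blockSet h (n + 1) ∩ height f (n + 1) ⁻¹' U)) * Q (stayForever h ∩ B) := by
  have hs := measurableSet_stayForever h
  have hpre : ∀ n, IsPrefixEvent n (height f n ⁻¹' U) := by
    intro n ω hω η hη
    rw [Set.mem_preimage, height_congr hη le_rfl]
    exact hω
  have hdecomp : stayForever h ∩ {ω | firstRegen h ω ≠ 0} ∩
      (blockSum h f ⁻¹' U ∩ nextPath h ⁻¹' B) =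
      ⋃ n, (blockSet h (n + 1) ∩ height f (n + 1) ⁻¹' U) ∩
        shift (n + 1) ⁻¹' (stayForever h ∩ B) := by
    ext ω
    have key : ∀ n, ω ∈ stayForever h ∧ firstRegen h ω = n + 1 ↔
        ω ∈ blockSet h (n + 1) ∧ shift (n + 1) ω ∈ stayForever h := fun n => by
      simpa using Set.ext_iff.1 (stayForever_inter_firstRegen (h := h) (Nat.le_add_left 1 n)) ω
    simp only [Set.mem_inter_iff, Set.mem_iUnion, Set.mem_preimage, Set.mem_ofPred_eq]
    constructor
    · rintro ⟨⟨h1, h2⟩, h3, h4⟩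
      obtain ⟨n, hn⟩ := Nat.exists_eq_succ_of_ne_zero h2
      have := (key n).1 ⟨h1, hn⟩
      rw [blockSum, hn] at h3
      rw [nextPath, hn] at h4
      exact ⟨n, ⟨this.1, h3⟩, this.2, h4⟩
    · rintro ⟨n, ⟨h1, h2⟩, h3, h4⟩
      have := (key n).2 ⟨h1, h3⟩
      refine ⟨⟨this.1, by omega⟩, ?_, ?_⟩
      · rw [blockSum, this.2]; exact h2
      · rw [nextPath, this.2]; exact h4
  have hA : ∀ n, IsPrefixEvent (n + 1) (blockSet h (n + 1) ∩ height f (n + 1) ⁻¹' U) :=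
    fun n => (isPrefixEvent_blockSet _).inter (hpre _)
  rw [hdecomp, measure_iUnion, ← ENNReal.tsum_mul_right]
  · refine tsum_congr fun n => ?_
    exact hQ.inter_shift (hA n) (fun ω hω => hω.1.1) (hs.inter hB) Set.inter_subset_left
  · have hlt : ∀ ω (i : ℕ), ω ∈ (blockSet h (i + 1) ∩ height f (i + 1) ⁻¹' U) ∩
        shift (i + 1) ⁻¹' (stayForever h ∩ B) → firstRegen h ω = i + 1 := by
      rintro ω i ⟨⟨h1, -⟩, h2, -⟩
      have : ω ∈ blockSet h (i + 1) ∩ shift (i + 1) ⁻¹' stayForever h := ⟨h1, h2⟩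
      rw [← stayForever_inter_firstRegen (Nat.le_add_left 1 i)] at this
      exact this.2
    intro i j hij
    rw [Function.onFun, Set.disjoint_left]
    intro ω hi hj
    have h1 := hlt ω i hi
    have h2 := hlt ω j hj
    omega
  · exact fun n => (hA n).measurableSet.inter (measurable_shift _ (hs.inter hB))

end Regeneration

/-! ### Independence of the blocks and the law of large numbers. -/

section RegenerationLimit

set_option linter.unusedSectionVars false

/-- A law of large numbers along the times `T n` extends to all times. -/
theorem tendsto_div_of_subsequence {S : ℕ → ℝ} (hS : Monotone S) (hS0 : S 0 = 0) {T : ℕ → ℕ}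
    (hT : Monotone T) (hT0 : T 0 = 0) {s t : ℝ} (ht : 0 < t)
    (hTt : Tendsto (fun n : ℕ => (T n : ℝ) / n) atTop (𝓝 t))
    (hSs : Tendsto (fun n : ℕ => S (T n) / n) atTop (𝓝 s)) :
    Tendsto (fun m : ℕ => S m / m) atTop (𝓝 (s / t)) := by
  have hTtop : Tendsto (fun n => (T n : ℝ)) atTop atTop := by
    refine (hTt.pos_mul_atTop ht tendsto_natCast_atTop_atTop).congr' ?_
    filter_upwards [eventually_gt_atTop 0] with n hn
    have : (n : ℝ) ≠ 0 := by positivity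
    field_simp
  have hTtop' : Tendsto T atTop atTop := tendsto_natCast_atTop_iff.1 hTtop
  have hex : ∀ m, ∃ k, m < T k := fun m => (hTtop'.eventually_gt_atTop m).exists
  classical
  -- The index with `T (κ m) ≤ m < T (κ m + 1)`. Monotonicity squeezes `S m / m` between `S (T (κ
  -- m)) / T (κ m + 1)` and `S (T (κ m + 1)) / T (κ m)`.
  let κ : ℕ → ℕ := fun m => Nat.find (hex m) - 1
  have hpos : ∀ m, 0 < Nat.find (hex m) := fun m => by
    rw [Nat.find_pos]
    simp [hT0]
  have hκ1 : ∀ m, m < T (κ m + 1) := fun m => by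
    have := Nat.find_spec (hex m)
    rwa [show κ m + 1 = Nat.find (hex m) from Nat.sub_add_cancel (hpos m)]
  have hκ2 : ∀ m, T (κ m) ≤ m := fun m => by
    have := Nat.find_min (hex m) (m := κ m) (Nat.sub_lt (hpos m) one_pos)
    omega
  have hκtop : Tendsto κ atTop atTop := by
    refine tendsto_atTop.2 fun K => ?_
    filter_upwards [eventually_ge_atTop (T K)] with m hm
    by_contra! hc
    have h1 := hT (show κ m + 1 ≤ K from hc)
    have h2 := hκ1 m
    omega
  have hratio : Tendsto (fun n : ℕ => ((n : ℝ) + 1) / n) atTop (𝓝 1) := by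
    have h1 := (tendsto_const_nhds (x := (1 : ℝ))).add tendsto_one_div_atTop_nhds_zero_nat
    rw [add_zero] at h1
    refine h1.congr' ?_
    filter_upwards [eventually_gt_atTop 0] with n hn
    have : (n : ℝ) ≠ 0 := by positivity
    field_simp
  have hsucc : Tendsto (fun n : ℕ => n + 1) atTop atTop := tendsto_add_atTop_nat 1
  have hlow : Tendsto (fun n : ℕ => S (T n) / T (n + 1)) atTop (𝓝 (s / t)) := by
    have h1 := hSs.div ((hTt.comp hsucc).mul hratio) (by simpa using ht.ne')
    rw [mul_one] at h1
    refine h1.congr' ?_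
    filter_upwards [eventually_gt_atTop 0] with n hn
    have h0 : (n : ℝ) ≠ 0 := by positivity
    have h2 : (n : ℝ) + 1 ≠ 0 := by positivity
    simp only [Pi.div_apply, Function.comp_apply, Nat.cast_add, Nat.cast_one]
    field_simp
  have hup : Tendsto (fun n : ℕ => S (T (n + 1)) / T n) atTop (𝓝 (s / t)) := by
    have h1 := ((hSs.comp hsucc).mul hratio).div hTt ht.ne'
    rw [mul_one] at h1
    refine h1.congr' ?_
    filter_upwards [eventually_gt_atTop 0] with n hn
    have h0 : (n : ℝ) ≠ 0 := by positivity
    have h2 : (n : ℝ) + 1 ≠ 0 := by positivity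
    simp only [Pi.div_apply, Function.comp_apply, Nat.cast_add, Nat.cast_one]
    field_simp
  have hSnn : ∀ m, 0 ≤ S m := fun m => hS0 ▸ hS (Nat.zero_le m)
  have hTκ : ∀ᶠ m in atTop, 0 < T (κ m) :=
    (hTtop'.comp hκtop).eventually_gt_atTop 0
  refine tendsto_of_tendsto_of_tendsto_of_le_of_le' (hlow.comp hκtop) (hup.comp hκtop) ?_ ?_
  · filter_upwards [eventually_gt_atTop 0] with m hm
    refine div_le_div₀ (hSnn m) (hS (hκ2 m)) (by exact_mod_cast hm) ?_
    exact_mod_cast (hκ1 m).le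
  · filter_upwards [hTκ] with m hm
    refine div_le_div₀ (hSnn _) (hS (hκ1 m).le) (by exact_mod_cast hm) ?_
    exact_mod_cast hκ2 m

theorem indepFun_comp_measurePreserving {α β γ δ : Type*} {mα : MeasurableSpace α}
    {mβ : MeasurableSpace β} {mγ : MeasurableSpace γ} {mδ : MeasurableSpace δ} {μ : Measure α}
    {ν : Measure β} {f : β → γ} {g : β → δ} {φ : α → β} (hfg : IndepFun f g ν) (hf : Measurable f)
    (hg : Measurable g) (hφ : MeasurePreserving φ μ ν) : IndepFun (f ∘ φ) (g ∘ φ) μ := by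
  rw [indepFun_iff_measure_inter_preimage_eq_mul] at hfg ⊢
  intro s t hs ht
  have := hfg s t hs ht
  rwa [← hφ.measure_preimage ((hf hs).inter (hg ht)).nullMeasurableSet,
    ← hφ.measure_preimage (hf hs).nullMeasurableSet,
    ← hφ.measure_preimage (hg ht).nullMeasurableSet] at this

variable {E : Type*} {h : E → ℝ}

/-- The time of the `k`-th regeneration. -/
noncomputable def regenTime (h : E → ℝ) (k : ℕ) (ω : ℕ → E) : ℕ :=
  ∑ j ∈ Finset.range k, firstRegen h ((nextPath h)^[j] ω)

theorem nextPath_iterate (k : ℕ) (ω : ℕ → E) :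
    (nextPath h)^[k] ω = shift (regenTime h k ω) ω := by
  induction k with
  | zero => simp [regenTime]
  | succ k ih =>
    rw [Function.iterate_succ_apply', regenTime, Finset.sum_range_succ, ← regenTime,
      ← shift_shift, ← ih, nextPath]

theorem sum_blockSum (f : E → ℝ) (k : ℕ) (ω : ℕ → E) :
    ∑ j ∈ Finset.range k, blockSum h f ((nextPath h)^[j] ω) = height f (regenTime h k ω) ω := by
  induction k with
  | zero => simp [regenTime]
  | succ k ih =>
    have hT : regenTime h (k + 1) ω = regenTime h k ω + firstRegen h ((nextPath h)^[k] ω) :=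
      Finset.sum_range_succ _ _
    rw [Finset.sum_range_succ, ih, hT, height_add, ← nextPath_iterate, blockSum]

theorem height_shift (f : E → ℝ) (n m : ℕ) (ω : ℕ → E) :
    height f m (shift n ω) = height f (n + m) ω - height f n ω := by
  rw [height_add]; ring

/-- Averages along a path and along its shift have the same limit. -/
theorem tendsto_average_of_shift {f : E → ℝ} {n : ℕ} {ω : ℕ → E} {α : ℝ}
    (H : Tendsto (fun m : ℕ => height f m (shift n ω) / m) atTop (𝓝 α)) :
    Tendsto (fun m : ℕ => height f m ω / m) atTop (𝓝 α) := by
  rw [← tendsto_add_atTop_iff_nat n]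
  have hratio : Tendsto (fun m : ℕ => (m : ℝ) / (m + n : ℕ)) atTop (𝓝 1) := by
    have := tendsto_natCast_div_add_atTop (𝕜 := ℝ) (n : ℝ)
    simpa using this
  have hc : Tendsto (fun m : ℕ => height f n ω / (m + n : ℕ)) atTop (𝓝 0) :=
    (tendsto_const_div_atTop_nhds_zero_nat (height f n ω)).comp (tendsto_add_atTop_nat n)
  have := (H.mul hratio).add hc
  rw [mul_one, add_zero] at this
  refine this.congr' ?_
  filter_upwards [eventually_gt_atTop 0] with m hm
  have h1 : (m : ℝ) ≠ 0 := by positivity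
  have h2 : ((m + n : ℕ) : ℝ) ≠ 0 := by positivity
  rw [height_shift, add_comm n m]
  field_simp
  ring

variable [MeasurableSpace E] [Countable E] [MeasurableSingletonClass E]
  {Q : Measure (ℕ → E)} [IsProbabilityMeasure Q]

/-- The number of records up to a time grows linearly in the mean. -/
def HasRecordDensity (h : E → ℝ) (Q : Measure (ℕ → E)) : Prop :=
  ∃ c : ℝ, 0 < c ∧ ∀ᶠ n : ℕ in atTop, c * n ≤ ∑ m ∈ Finset.range n, Q.real (recordSet h m)

theorem RenewsAtRecords.summable (hQ : RenewsAtRecords h Q) (hd : HasRecordDensity h Q) :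
    Summable fun n => Q.real (stayForever h ∩ noRegenSet h n) := by
  obtain ⟨c, hc, hd⟩ := hd
  exact summable_of_renewal (fun _ => measureReal_nonneg) (fun _ => measureReal_nonneg)
    hQ.sum_le_one hc hd

/-- The value `0` means that there is no regeneration at all, so the event lies in every `noRegenSet
h n`; the probabilities of these, together with staying nonnegative, are summable and hence tend to
zero. -/
theorem RenewsAtRecords.measure_firstRegen_eq_zero (hQ : RenewsAtRecords h Q)
    (hd : HasRecordDensity h Q) : Q (stayForever h ∩ {ω | firstRegen h ω = 0}) = 0 := by
  rw [← measureReal_eq_zero_iff]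
  refine le_antisymm (ge_of_tendsto' (hQ.summable hd).tendsto_atTop_zero fun n => ?_)
    measureReal_nonneg
  refine measureReal_mono (Set.inter_subset_inter_right _ fun ω hω m hm hmn hr => ?_)
  have hle : 1 ≤ firstRegen h ω :=
    (Nat.sInf_mem (s := {n | 1 ≤ n ∧ ω ∈ regenSet h n}) ⟨m, hm, hr⟩).1
  rw [Set.mem_ofPred_eq] at hω
  omega

theorem RenewsAtRecords.measure_block' (hQ : RenewsAtRecords h Q)
    (hd : HasRecordDensity h Q) (f : E → ℝ) {U : Set ℝ} {B : Set (ℕ → E)} (hB : MeasurableSet B) :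
    Q (stayForever h ∩ (blockSum h f ⁻¹' U ∩ nextPath h ⁻¹' B)) =
      (∑' n, Q (blockSet h (n + 1) ∩ height f (n + 1) ⁻¹' U)) * Q (stayForever h ∩ B) := by
  rw [← hQ.measure_block f hB]
  refine measure_congr ?_
  have := measure_eq_zero_iff_ae_notMem.1 (hQ.measure_firstRegen_eq_zero hd)
  filter_upwards [this] with ω hω
  refine propext ⟨fun H => ⟨⟨H.1, fun h0 => hω ⟨H.1, h0⟩⟩, H.2⟩, fun H => ⟨H.1.1, H.2⟩⟩

/-- Taking `B` to be everything in the product formula identifies its block factor as a conditional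
probability. -/
theorem RenewsAtRecords.tsum_eq_cond (hQ : RenewsAtRecords h Q)
    (hd : HasRecordDensity h Q) (hD : Q (stayForever h) ≠ 0) (f : E → ℝ) {U : Set ℝ} :
    ∑' n, Q (blockSet h (n + 1) ∩ height f (n + 1) ⁻¹' U) =
      Q[|stayForever h] (blockSum h f ⁻¹' U) := by
  have := hQ.measure_block' hd f (U := U) MeasurableSet.univ
  rw [Set.preimage_univ, Set.inter_univ, Set.inter_univ] at this
  rw [cond_apply (measurableSet_stayForever h), this, mul_comm, mul_assoc,
    ENNReal.mul_inv_cancel hD (measure_ne_top _ _), mul_one]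

theorem RenewsAtRecords.cond_inter (hQ : RenewsAtRecords h Q)
    (hd : HasRecordDensity h Q) (hD : Q (stayForever h) ≠ 0) (f : E → ℝ) {U : Set ℝ}
    {B : Set (ℕ → E)} (hB : MeasurableSet B) :
    Q[|stayForever h] (blockSum h f ⁻¹' U ∩ nextPath h ⁻¹' B) =
      Q[|stayForever h] (blockSum h f ⁻¹' U) * Q[|stayForever h] B := by
  rw [← hQ.tsum_eq_cond hd hD f, cond_apply (measurableSet_stayForever h), hQ.measure_block' hd f hB,
    cond_apply (measurableSet_stayForever h)]
  ring

theorem RenewsAtRecords.measurePreserving (hQ : RenewsAtRecords h Q)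
    (hd : HasRecordDensity h Q) (hD : Q (stayForever h) ≠ 0) :
    MeasurePreserving (nextPath h) Q[|stayForever h] Q[|stayForever h] := by
  have := cond_isProbabilityMeasure hD
  refine ⟨measurable_nextPath, Measure.ext fun B hB => ?_⟩
  rw [Measure.map_apply measurable_nextPath hB]
  simpa using hQ.cond_inter hd hD 0 (U := Set.univ) hB

theorem RenewsAtRecords.indepFun (hQ : RenewsAtRecords h Q)
    (hd : HasRecordDensity h Q) (hD : Q (stayForever h) ≠ 0) (f : E → ℝ) :
    IndepFun (blockSum h f) (nextPath h) Q[|stayForever h] := by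
  rw [indepFun_iff_measure_inter_preimage_eq_mul]
  intro U B _ hB
  rw [hQ.cond_inter hd hD f hB, (hQ.measurePreserving hd hD).measure_preimage hB.nullMeasurableSet]

/-- The mean is the sum of the tails, and a first regeneration after time `n` forces the path into
`noRegenSet h n`; the renewal bound makes these probabilities summable. -/
theorem RenewsAtRecords.lintegral_firstRegen (hQ : RenewsAtRecords h Q)
    (hd : HasRecordDensity h Q) (hD : Q (stayForever h) ≠ 0) :
    ∫⁻ ω, (firstRegen h ω : ENNReal) ∂Q[|stayForever h] ≠ ⊤ := by
  have hsum : ∀ ω : ℕ → E, (firstRegen h ω : ENNReal) =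
      ∑' n : ℕ, {ω | n < firstRegen h ω}.indicator (fun _ => (1 : ENNReal)) ω := by
    intro ω
    rw [tsum_eq_sum (s := Finset.range (firstRegen h ω))]
    · rw [Finset.sum_congr rfl (g := fun _ => (1 : ENNReal))]
      · simp
      · intro n hn
        simpa using hn
    · intro n hn
      simpa using hn
  have hm : ∀ n : ℕ, MeasurableSet {ω | n < firstRegen h ω} := fun n =>
    measurable_firstRegen measurableSet_Ioi
  simp_rw [hsum]
  rw [lintegral_tsum fun n => (measurable_const.indicator (hm n)).aemeasurable]
  have hle : ∀ n : ℕ, ∫⁻ ω, {ω | n < firstRegen h ω}.indicator (fun _ => (1 : ENNReal)) ω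
      ∂Q[|stayForever h] ≤ (Q (stayForever h))⁻¹ * Q (stayForever h ∩ noRegenSet h n) := by
    intro n
    rw [lintegral_indicator_const (hm n), one_mul, cond_apply (measurableSet_stayForever h)]
    gcongr
    intro ω hω m hm hmn hr
    have : firstRegen h ω ≤ m := Nat.sInf_le ⟨hm, hr⟩
    rw [Set.mem_ofPred_eq] at hω
    omega
  refine ne_top_of_le_ne_top ?_ (ENNReal.tsum_le_tsum hle)
  rw [ENNReal.tsum_mul_left]
  refine ENNReal.mul_ne_top (ENNReal.inv_ne_top.2 hD) ?_
  have := (hQ.summable hd).tsum_ofReal_ne_top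
  simpa [measureReal_def, ENNReal.ofReal_toReal, measure_ne_top] using this

theorem RenewsAtRecords.integrable_blockSum (hQ : RenewsAtRecords h Q)
    (hd : HasRecordDensity h Q) (hD : Q (stayForever h) ≠ 0) {f : E → ℝ} (hf : ∀ e, |f e| ≤ 1) :
    Integrable (blockSum h f) Q[|stayForever h] := by
  refine ⟨(measurable_blockSum f).aestronglyMeasurable, ?_⟩
  refine lt_of_le_of_lt (lintegral_mono fun ω => ?_) (hQ.lintegral_firstRegen hd hD).lt_top
  rw [Real.enorm_eq_ofReal_abs, ← ENNReal.ofReal_natCast]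
  refine ENNReal.ofReal_le_ofReal ?_
  rw [blockSum, height]
  refine (Finset.abs_sum_le_sum_abs _ _).trans ?_
  exact (Finset.sum_le_sum fun i _ => hf (ω i)).trans (by simp)

/-- The strong law requires only pairwise independence. For the blocks `i` and `i + k + 1` this is
the independence of block and next path, transported by the measure-preserving map `(nextPath
h)^[i]`. -/
theorem RenewsAtRecords.tendsto_blockSum (hQ : RenewsAtRecords h Q)
    (hd : HasRecordDensity h Q) (hD : Q (stayForever h) ≠ 0) {f : E → ℝ} (hf : ∀ e, |f e| ≤ 1) :
    ∀ᵐ ω ∂Q[|stayForever h], Tendsto (fun n : ℕ => height f (regenTime h n ω) ω / n) atTop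
      (𝓝 (∫ ω, blockSum h f ω ∂Q[|stayForever h])) := by
  have hmp := hQ.measurePreserving hd hD
  have hmY := measurable_blockSum (h := h) f
  have hpair : ∀ i k, IndepFun (fun ω => blockSum h f ((nextPath h)^[i] ω))
      (fun ω => blockSum h f ((nextPath h)^[i + (k + 1)] ω)) Q[|stayForever h] := by
    intro i k
    have h0 : IndepFun (blockSum h f) (fun ω => blockSum h f ((nextPath h)^[k + 1] ω))
        Q[|stayForever h] := by
      have := (hQ.indepFun hd hD f).comp measurable_id
        (hmY.comp ((measurable_nextPath (h := h)).iterate k))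
      simpa [Function.comp_def] using this
    have := indepFun_comp_measurePreserving h0 hmY (hmY.comp (measurable_nextPath.iterate _))
      (hmp.iterate i)
    simpa only [Function.comp_def, ← Function.iterate_add_apply, add_comm i] using this
  have hslln := strong_law_ae_real (μ := Q[|stayForever h])
    (fun k ω => blockSum h f ((nextPath h)^[k] ω)) (hQ.integrable_blockSum hd hD hf) ?_ ?_
  · simpa only [sum_blockSum, Function.iterate_zero_apply] using hslln
  · intro i j hij
    rcases lt_or_gt_of_ne hij with hlt | hlt
    · obtain ⟨k, rfl⟩ := Nat.exists_eq_add_of_lt hlt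
      exact hpair i k
    · obtain ⟨k, rfl⟩ := Nat.exists_eq_add_of_lt hlt
      exact (hpair j k).symm
  · intro i
    have hi := hmp.iterate i
    refine ⟨(hmY.comp hi.measurable).aemeasurable, hmY.aemeasurable, ?_⟩
    change Measure.map (blockSum h f ∘ (nextPath h)^[i]) _ = Measure.map (blockSum h f) _
    rw [← Measure.map_map hmY hi.measurable, hi.map_eq]

theorem RenewsAtRecords.tendsto_average_cond (hQ : RenewsAtRecords h Q)
    (hd : HasRecordDensity h Q) (hD : Q (stayForever h) ≠ 0) {f : E → ℝ}
    (hf : ∀ e, f e ∈ Set.Icc 0 1) :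
    ∃ α : ℝ, ∀ᵐ ω ∂Q[|stayForever h],
      Tendsto (fun n : ℕ => height f n ω / n) atTop (𝓝 α) := by
  have hprob := cond_isProbabilityMeasure hD
  have hone : ∀ (n : ℕ) (ω : ℕ → E), height (fun _ => 1) n ω = n := by simp [height]
  have hblock : ∀ ω : ℕ → E, blockSum h (fun _ => 1) ω = firstRegen h ω := fun ω => hone _ _
  have hint1 := hQ.integrable_blockSum hd hD (f := fun _ => 1) (by simp)
  have hτ : ∀ᵐ ω ∂Q[|stayForever h], firstRegen h ω ≠ 0 := by
    rw [ae_iff]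
    simp only [not_not, ne_eq]
    rw [cond_apply (measurableSet_stayForever h), hQ.measure_firstRegen_eq_zero hd, mul_zero]
  have ht : 0 < ∫ ω, blockSum h (fun _ => 1) ω ∂Q[|stayForever h] := by
    refine lt_of_lt_of_le one_pos ?_
    calc (1 : ℝ) = ∫ ω, (1 : ℝ) ∂Q[|stayForever h] := by simp
      _ ≤ _ := by
        refine integral_mono_ae (integrable_const _) hint1 ?_
        filter_upwards [hτ] with ω hω
        rw [hblock]
        exact_mod_cast Nat.one_le_iff_ne_zero.2 hω
  -- The limit is the mean block sum of `f` over the mean block length, which is the block sum of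
  -- the constant `1`.
  refine ⟨(∫ ω, blockSum h f ω ∂Q[|stayForever h]) /
    ∫ ω, blockSum h (fun _ => 1) ω ∂Q[|stayForever h], ?_⟩
  filter_upwards [hQ.tendsto_blockSum hd hD (f := f)
      fun e => abs_le.2 ⟨by linarith [(hf e).1], (hf e).2⟩,
    hQ.tendsto_blockSum hd hD (f := fun _ => 1) (by simp)] with ω h1 h2
  simp only [hone] at h2
  refine tendsto_div_of_subsequence (monotone_nat_of_le_succ fun n => ?_) (height_zero f ω)
    (monotone_nat_of_le_succ fun n => ?_) (by simp [regenTime]) ht h2 h1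
  · rw [height_succ]
    linarith [(hf (ω n)).1]
  · rw [regenTime, regenTime, Finset.sum_range_succ]
    exact Nat.le_add_right _ _

/-- Wait for the first record at or after time `N`. That it occurs at `n`, together with `C`, is
decided by `n` steps, and independently of these the record is then undershot with probability `1 -
Q (stayForever h)`. -/
theorem RenewsAtRecords.inter_noRegen_le (hQ : RenewsAtRecords h Q)
    (hr : ∀ᵐ ω ∂Q, ∀ N, ∃ n ≥ N, ω ∈ recordSet h n) {N : ℕ} {C : Set (ℕ → E)}
    (hC : IsPrefixEvent N C) :
    Q (C ∩ ⋂ n, (regenSet h n)ᶜ) ≤ (1 - Q (stayForever h)) * Q C := by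
  set F : ℕ → Set (ℕ → E) := fun n => {ω | N ≤ n ∧ ω ∈ C ∧ ω ∈ recordSet h n ∧
    ∀ m, N ≤ m → m < n → ω ∉ recordSet h m} with hF
  have hs := measurableSet_stayForever h
  have hFp : ∀ n, IsPrefixEvent n (F n) := by
    rintro n ω ⟨h1, h2, h3, h4⟩ η hη
    refine ⟨h1, hC.mono h1 ω h2 hη, isPrefixEvent_recordSet h n ω h3 hη, fun m hm hmn hrec => ?_⟩
    exact h4 m hm hmn ((isPrefixEvent_recordSet h m).mono hmn.le η hrec
      ((PiNat.mem_cylinder_comm _ _ _).1 hη))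
  have hFd : Pairwise (Function.onFun Disjoint F) := by
    intro i j hij
    rw [Function.onFun, Set.disjoint_left]
    rintro ω ⟨h1, -, h3, h4⟩ ⟨h5, -, h7, h8⟩
    rcases lt_or_gt_of_ne hij with hlt | hlt
    · exact h8 i h1 hlt h3
    · exact h4 j h5 hlt h7
  have hterm : ∀ n, Q (F n \ shift n ⁻¹' stayForever h) =
      (1 - Q (stayForever h)) * Q (F n) := by
    intro n
    rw [← Set.sdiff_self_inter, measure_sdiff Set.inter_subset_left
      ((hFp n).measurableSet.inter (measurable_shift n hs)).nullMeasurableSet (measure_ne_top _ _),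
      hQ.inter_shift (hFp n) (fun ω hω => hω.2.2.1) hs subset_rfl, ENNReal.sub_mul, one_mul,
      mul_comm]
    exact fun _ _ => measure_ne_top _ _
  calc Q (C ∩ ⋂ n, (regenSet h n)ᶜ) ≤ Q (⋃ n, F n \ shift n ⁻¹' stayForever h) := by
        refine measure_mono_ae ?_
        filter_upwards [hr] with ω hω hωG
        classical
        have hmin := Nat.find_spec (hω N)
        refine Set.mem_iUnion.2 ⟨Nat.find (hω N), ⟨hmin.1, hωG.1, hmin.2, fun m hm hlt hrec =>
          Nat.find_min (hω N) hlt ⟨hm, hrec⟩⟩, fun hst => ?_⟩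
        exact Set.mem_iInter.1 hωG.2 _ ⟨hmin.2, hst⟩
    _ ≤ ∑' n, Q (F n \ shift n ⁻¹' stayForever h) := measure_iUnion_le _
    _ = (1 - Q (stayForever h)) * ∑' n, Q (F n) := by simp_rw [hterm, ENNReal.tsum_mul_left]
    _ = (1 - Q (stayForever h)) * Q (⋃ n, F n) := by
        rw [measure_iUnion hFd fun n => (hFp n).measurableSet]
    _ ≤ (1 - Q (stayForever h)) * Q C := by
        gcongr
        exact Set.iUnion_subset fun n ω hω => hω.2.1

/-- A zero-one argument: the event `G` of no regeneration is approximated by prefix events `C`, each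
of which has at most the fraction `1 - q` of its mass in `G`. In the limit `Q G ≤ (1 - q) * Q G`, so
`G` is null. -/
theorem RenewsAtRecords.ae_exists_regen (hQ : RenewsAtRecords h Q)
    (hr : ∀ᵐ ω ∂Q, ∀ N, ∃ n ≥ N, ω ∈ recordSet h n) (hD : Q (stayForever h) ≠ 0) :
    ∀ᵐ ω ∂Q, ∃ n, ω ∈ regenSet h n := by
  set G : Set (ℕ → E) := ⋂ n, (regenSet h n)ᶜ with hG
  have hGm : MeasurableSet G := MeasurableSet.iInter fun n => (measurableSet_regenSet h n).compl
  have hdense := Measure.MeasureDense.of_generateFrom_isSetAlgebra_finite (μ := Q)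
    isSetAlgebra_prefixEvents generateFrom_prefixEvents
  set q := Q.real (stayForever h) with hq
  have hq0 : 0 < q := ENNReal.toReal_pos hD (measure_ne_top _ _)
  have hq1 : q ≤ 1 := measureReal_le_one
  have hkey : ∀ ε : ℝ, 0 < ε → Q.real G ≤ (1 - q) * (Q.real G + ε) + ε := by
    intro ε hε
    obtain ⟨C, ⟨N, hC⟩, hlt⟩ := hdense.approx G hGm (measure_ne_top _ _) ε hε
    have hlt' : Q.real (symmDiff G C) ≤ ε :=
      ENNReal.toReal_le_of_le_ofReal hε.le hlt.le
    have h1 : Q.real (C ∩ G) ≤ (1 - q) * Q.real C := by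
      have := ENNReal.toReal_mono (ENNReal.mul_ne_top (by simp) (measure_ne_top _ _))
        (hQ.inter_noRegen_le hr hC)
      rwa [ENNReal.toReal_mul, ENNReal.toReal_sub_of_le prob_le_one ENNReal.one_ne_top,
        ENNReal.toReal_one] at this
    have h2 : Q.real C ≤ Q.real G + Q.real (symmDiff G C) := by
      refine (measureReal_mono fun ω hω => ?_).trans (measureReal_union_le _ _)
      by_cases hg : ω ∈ G
      · exact Or.inl hg
      · exact Or.inr (Or.inr ⟨hω, hg⟩)
    have h3 : Q.real G ≤ Q.real (C ∩ G) + Q.real (symmDiff G C) := by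
      refine (measureReal_mono fun ω hω => ?_).trans (measureReal_union_le _ _)
      by_cases hg : ω ∈ C
      · exact Or.inl ⟨hg, hω⟩
      · exact Or.inr (Or.inl ⟨hω, hg⟩)
    have h4 : (1 - q) * Q.real C ≤ (1 - q) * (Q.real G + ε) :=
      mul_le_mul_of_nonneg_left (by linarith) (by linarith)
    linarith
  have hG0 : Q.real G = 0 := by
    refine le_antisymm ?_ measureReal_nonneg
    by_contra! hpos
    -- The inequality gives `q * Q.real G ≤ 2 * ε`, which this `ε` violates.
    have := hkey (q * Q.real G / 4) (by positivity)
    nlinarith [mul_pos hq0 hpos]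
  rw [measureReal_eq_zero_iff] at hG0
  filter_upwards [measure_eq_zero_iff_ae_notMem.1 hG0] with ω hω
  simpa [hG] using hω

/-- The law of large numbers for paths with renewals at records. -/
theorem RenewsAtRecords.tendsto_average (hQ : RenewsAtRecords h Q)
    (hd : HasRecordDensity h Q) (hr : ∀ᵐ ω ∂Q, ∀ N, ∃ n ≥ N, ω ∈ recordSet h n)
    (hD : Q (stayForever h) ≠ 0) {f : E → ℝ} (hf : ∀ e, f e ∈ Set.Icc 0 1) :
    ∃ α : ℝ, ∀ᵐ ω ∂Q, Tendsto (fun n : ℕ => height f n ω / n) atTop (𝓝 α) := by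
  obtain ⟨α, hα⟩ := hQ.tendsto_average_cond hd hD hf
  refine ⟨α, ?_⟩
  set L : Set (ℕ → E) := {ω | Tendsto (fun n : ℕ => height f n ω / n) atTop (𝓝 α)} with hL
  have hLm : MeasurableSet L :=
    measurableSet_tendsto _ fun n => (measurable_height f n).div_const _
  have hnull : Q (stayForever h ∩ Lᶜ) = 0 := by
    have h1 : Q[|stayForever h] Lᶜ = 0 := hα
    rw [cond_apply (measurableSet_stayForever h)] at h1
    exact (mul_eq_zero.1 h1).resolve_left (ENNReal.inv_ne_zero.2 (measure_ne_top _ _))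
  have hn : ∀ n, ∀ᵐ ω ∂Q, ω ∈ regenSet h n → shift n ω ∈ L := by
    intro n
    have h1 := hQ.inter_shift (isPrefixEvent_recordSet h n) subset_rfl
      ((measurableSet_stayForever h).inter hLm.compl) Set.inter_subset_left
    rw [hnull, mul_zero] at h1
    filter_upwards [measure_eq_zero_iff_ae_notMem.1 h1] with ω hω hreg
    by_contra hc
    exact hω ⟨hreg.1, hreg.2, hc⟩
  filter_upwards [hQ.ae_exists_regen hr hD, ae_all_iff.2 hn] with ω ⟨n, hreg⟩ hω
  exact tendsto_average_of_shift (hω n hreg)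

end RegenerationLimit

/-! ### Exponential estimates: linear growth, density of records, positivity of `stayForever`. -/

section Concentration

set_option linter.unusedSectionVars false

variable {E : Type*}

/-- `K n ω e` is the probability that the step at time `n` is `e`, given that the first `n` steps
are those of `ω`. -/
structure HasKernel [MeasurableSpace E] (K : ℕ → (ℕ → E) → E → ENNReal)
    (Q : Measure (ℕ → E)) : Prop where
  congr : ∀ n ω, ∀ η ∈ PiNat.cylinder ω n, K n η = K n ω
  cylinder_succ : ∀ n ω, Q (PiNat.cylinder ω (n + 1)) = Q (PiNat.cylinder ω n) * K n ω (ω n)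

/-- The conditional exponential moments of `f` are uniformly smaller than `1`. -/
def IsContracting (K : ℕ → (ℕ → E) → E → ENNReal) (f : E → ℝ) : Prop :=
  ∃ ρ : ENNReal, ρ < 1 ∧ ∀ n ω, ∑' e, K n ω e * ENNReal.ofReal (Real.exp (f e)) ≤ ρ

theorem cylinder_inter_eq (ω : ℕ → E) (n : ℕ) (e : E) :
    PiNat.cylinder ω n ∩ {η | η n = e} = PiNat.cylinder (Function.update ω n e) (n + 1) := by
  ext η
  simp only [Set.mem_inter_iff, PiNat.mem_cylinder_iff, Set.mem_ofPred_eq]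
  constructor
  · rintro ⟨h1, h2⟩ i hi
    rcases Nat.lt_succ_iff_lt_or_eq.1 hi with hlt | rfl
    · rw [Function.update_of_ne hlt.ne, h1 i hlt]
    · simpa using h2
  · intro H
    refine ⟨fun i hi => ?_, by simpa using H n (Nat.lt_succ_self n)⟩
    rw [H i (by omega), Function.update_of_ne hi.ne]

theorem height_const_mul (c : ℝ) (f : E → ℝ) (n : ℕ) (ω : ℕ → E) :
    height (fun e => c * f e) n ω = c * height f n ω := by
  simp [height, Finset.mul_sum]

/-- The running maximum rises only at records, each time by at most `κ` plus the excess of the jump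
over `κ`. A high path without huge jumps must therefore have many records. -/
theorem height_le_records (h : E → ℝ) {κ : ℝ} (hκ : 0 ≤ κ) (n : ℕ) (ω : ℕ → E) :
    ∀ k ≤ n, height h k ω ≤
      κ * ∑ m ∈ Finset.range (n + 1), (recordSet h m).indicator (fun _ => (1 : ℝ)) ω +
        height (fun e => max (h e - κ) 0) n ω := by
  have hnn : ∀ m, (0 : ℝ) ≤ (recordSet h m).indicator (fun _ => (1 : ℝ)) ω := fun m =>
    Set.indicator_nonneg (fun _ _ => zero_le_one) _
  induction n with
  | zero =>
    intro k hk
    obtain rfl := Nat.le_zero.1 hk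
    simp only [height_zero, add_zero]
    exact mul_nonneg hκ (Finset.sum_nonneg fun m _ => hnn m)
  | succ n ih =>
    intro k hk
    have hstep := height_succ (fun e => max (h e - κ) 0) n ω
    have h0 : 0 ≤ max (h (ω n) - κ) 0 := le_max_right _ _
    have h1 := mul_nonneg hκ (hnn (n + 1))
    rw [Finset.sum_range_succ, mul_add, hstep]
    rcases Nat.le_succ_iff.1 hk with hk' | rfl
    · have := ih k hk'
      linarith
    · by_cases hrec : ω ∈ recordSet h (n + 1)
      · have h2 := ih n le_rfl
        have h3 : h (ω n) - κ ≤ max (h (ω n) - κ) 0 := le_max_left _ _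
        rw [height_succ, Set.indicator_of_mem hrec]
        linarith
      · simp only [recordSet, Set.mem_ofPred_eq, not_forall, not_lt] at hrec
        obtain ⟨m, hm, hle⟩ := hrec
        have h2 := ih m (by omega)
        linarith

theorem exists_record_of_tendsto {h : E → ℝ} {ω : ℕ → E}
    (H : Tendsto (fun n => height h n ω) atTop atTop) (N : ℕ) : ∃ n ≥ N, ω ∈ recordSet h n := by
  classical
  obtain ⟨B, hB⟩ : ∃ B, ∀ m < N, height h m ω ≤ B := by
    obtain ⟨B, hB⟩ := (Set.finite_Iio N).image (fun m => height h m ω) |>.bddAbove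
    exact ⟨B, fun m hm => hB ⟨m, hm, rfl⟩⟩
  have hex : ∃ n, N ≤ n ∧ B < height h n ω :=
    ((eventually_ge_atTop N).and (H.eventually_gt_atTop B)).exists
  obtain ⟨h1, h2⟩ := Nat.find_spec hex
  refine ⟨Nat.find hex, h1, fun m hm => ?_⟩
  rcases lt_or_ge m N with hmN | hmN
  · exact (hB m hmN).trans_lt h2
  · have := Nat.find_min hex hm
    push Not at this
    exact (this hmN).trans_lt h2

variable [MeasurableSpace E] [Countable E] [MeasurableSingletonClass E]
  {K : ℕ → (ℕ → E) → E → ENNReal} {Q : Measure (ℕ → E)} [IsProbabilityMeasure Q]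

theorem HasKernel.measure_cylinder_inter (hK : HasKernel K Q) (n : ℕ) (ω : ℕ → E) (e : E) :
    Q (PiNat.cylinder ω n ∩ {η | η n = e}) = Q (PiNat.cylinder ω n) * K n ω e := by
  have hu := PiNat.update_mem_cylinder ω n e
  rw [cylinder_inter_eq, hK.cylinder_succ, hK.congr n ω _ hu, PiNat.mem_cylinder_iff_eq.1 hu,
    Function.update_self]

theorem HasKernel.setLIntegral_cylinder (hK : HasKernel K Q) (n : ℕ) (ω : ℕ → E)
    (g : E → ENNReal) : ∫⁻ η in PiNat.cylinder ω n, g (η n) ∂Q =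
      Q (PiNat.cylinder ω n) * ∑' e, K n ω e * g e := by
  have hev : Measurable fun η : ℕ → E => η n := measurable_pi_apply n
  rw [← lintegral_map (measurable_of_countable g) hev, lintegral_countable',
    ← ENNReal.tsum_mul_left]
  refine tsum_congr fun e => ?_
  rw [Measure.map_apply hev (measurableSet_singleton e),
    Measure.restrict_apply (hev (measurableSet_singleton e)), Set.inter_comm]
  have := hK.measure_cylinder_inter n ω e
  rw [show (fun η : ℕ → E => η n) ⁻¹' {e} = {η | η n = e} from rfl, this]
  ring

/-- The exponential of the partial sums is a supermartingale up to the factor `ρ`. On a cylinder of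
length `n` the past factor is constant and the kernel integrates the last one. -/
theorem HasKernel.setLIntegral_exp_succ (hK : HasKernel K Q) {f : E → ℝ} {ρ : ENNReal}
    (hρ : ∀ n ω, ∑' e, K n ω e * ENNReal.ofReal (Real.exp (f e)) ≤ ρ) {n : ℕ}
    {A : Set (ℕ → E)} (hA : IsPrefixEvent n A) :
    ∫⁻ ω in A, ENNReal.ofReal (Real.exp (height f (n + 1) ω)) ∂Q ≤
      ρ * ∫⁻ ω in A, ENNReal.ofReal (Real.exp (height f n ω)) ∂Q := by
  have := hA.measure_le
    (μ := Q.withDensity fun ω => ENNReal.ofReal (Real.exp (height f (n + 1) ω)))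
    (ν := ρ • Q.withDensity fun ω => ENNReal.ofReal (Real.exp (height f n ω))) fun ω _ => ?_
  · rwa [Measure.smul_apply, smul_eq_mul, withDensity_apply _ hA.measurableSet,
      withDensity_apply _ hA.measurableSet] at this
  · have hc := (isPrefixEvent_cylinder ω n).measurableSet
    rw [Measure.smul_apply, smul_eq_mul, withDensity_apply _ hc, withDensity_apply _ hc]
    have h1 : ∫⁻ η in PiNat.cylinder ω n, ENNReal.ofReal (Real.exp (height f (n + 1) η)) ∂Q =
        ∫⁻ η in PiNat.cylinder ω n, ENNReal.ofReal (Real.exp (height f n ω)) *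
          ENNReal.ofReal (Real.exp (f (η n))) ∂Q := by
      refine setLIntegral_congr_fun hc fun η hη => ?_
      rw [height_succ, Real.exp_add, ENNReal.ofReal_mul (Real.exp_pos _).le,
        height_congr hη le_rfl]
    have h2 : ∫⁻ η in PiNat.cylinder ω n, ENNReal.ofReal (Real.exp (height f n η)) ∂Q =
        ∫⁻ η in PiNat.cylinder ω n, ENNReal.ofReal (Real.exp (height f n ω)) ∂Q := by
      refine setLIntegral_congr_fun hc fun η hη => ?_
      rw [height_congr hη le_rfl]
    rw [h1, h2, lintegral_const_mul' _ _ ENNReal.ofReal_ne_top,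
      hK.setLIntegral_cylinder n ω fun e => ENNReal.ofReal (Real.exp (f e)), setLIntegral_const]
    calc _ ≤ ENNReal.ofReal (Real.exp (height f n ω)) * (Q (PiNat.cylinder ω n) * ρ) := by
          gcongr
          exact hρ n ω
      _ = _ := by ring

theorem HasKernel.setLIntegral_exp_add (hK : HasKernel K Q) {f : E → ℝ} {ρ : ENNReal}
    (hρ : ∀ n ω, ∑' e, K n ω e * ENNReal.ofReal (Real.exp (f e)) ≤ ρ) {n : ℕ}
    {A : Set (ℕ → E)} (hA : IsPrefixEvent n A) (k : ℕ) :
    ∫⁻ ω in A, ENNReal.ofReal (Real.exp (height f (n + k) ω)) ∂Q ≤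
      ρ ^ k * ∫⁻ ω in A, ENNReal.ofReal (Real.exp (height f n ω)) ∂Q := by
  induction k with
  | zero => simp
  | succ k ih =>
    refine (hK.setLIntegral_exp_succ hρ (hA.mono (Nat.le_add_right n k))).trans ?_
    rw [pow_succ', mul_assoc]
    gcongr

theorem HasKernel.measure_inter_le (hK : HasKernel K Q) {f : E → ℝ} {ρ : ENNReal}
    (hρ : ∀ n ω, ∑' e, K n ω e * ENNReal.ofReal (Real.exp (f e)) ≤ ρ) (n : ℕ)
    (ω : ℕ → E) (k : ℕ) :
    Q (PiNat.cylinder ω n ∩ {η | 0 ≤ height f (n + k) η}) ≤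
      ρ ^ k * (ENNReal.ofReal (Real.exp (height f n ω)) * Q (PiNat.cylinder ω n)) := by
  have hc := (isPrefixEvent_cylinder ω n).measurableSet
  have hm : MeasurableSet {η : ℕ → E | 0 ≤ height f (n + k) η} :=
    measurable_height f (n + k) measurableSet_Ici
  calc Q (PiNat.cylinder ω n ∩ {η | 0 ≤ height f (n + k) η})
      = ∫⁻ η in PiNat.cylinder ω n,
          {η | 0 ≤ height f (n + k) η}.indicator (fun _ => (1 : ENNReal)) η ∂Q := by
        rw [lintegral_indicator_const hm, one_mul, Measure.restrict_apply hm, Set.inter_comm]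
    _ ≤ ∫⁻ η in PiNat.cylinder ω n, ENNReal.ofReal (Real.exp (height f (n + k) η)) ∂Q := by
        refine lintegral_mono fun η => ?_
        by_cases hη : 0 ≤ height f (n + k) η
        · rw [Set.indicator_of_mem (s := {η | 0 ≤ height f (n + k) η}) hη, ← ENNReal.ofReal_one]
          exact ENNReal.ofReal_le_ofReal (Real.one_le_exp hη)
        · rw [Set.indicator_of_notMem (s := {η | 0 ≤ height f (n + k) η}) hη]
          positivity
    _ ≤ ρ ^ k * ∫⁻ η in PiNat.cylinder ω n, ENNReal.ofReal (Real.exp (height f n η)) ∂Q :=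
        hK.setLIntegral_exp_add hρ (isPrefixEvent_cylinder ω n) k
    _ = _ := by
        rw [← setLIntegral_const]
        congr 1
        refine setLIntegral_congr_fun hc fun η hη => ?_
        rw [height_congr hη le_rfl]

theorem HasKernel.measure_le_pow (hK : HasKernel K Q) {f : E → ℝ} {ρ : ENNReal}
    (hρ : ∀ n ω, ∑' e, K n ω e * ENNReal.ofReal (Real.exp (f e)) ≤ ρ) (n : ℕ) :
    Q {η | 0 ≤ height f n η} ≤ ρ ^ n := by
  obtain ⟨ω⟩ : Nonempty (ℕ → E) := nonempty_of_isProbabilityMeasure Q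
  simpa using hK.measure_inter_le hρ 0 ω n

theorem HasKernel.tsum_measure_ne_top (hK : HasKernel K Q) {f : E → ℝ} (hf : IsContracting K f) :
    ∑' n, Q {η | 0 ≤ height f n η} ≠ ⊤ := by
  obtain ⟨ρ, hρ1, hρ⟩ := hf
  refine ne_top_of_le_ne_top ?_ (ENNReal.tsum_le_tsum fun n => hK.measure_le_pow hρ n)
  rw [ENNReal.tsum_geometric]
  exact ENNReal.inv_ne_top.2 (tsub_pos_of_lt hρ1).ne'

theorem HasKernel.ae_eventually_neg (hK : HasKernel K Q) {f : E → ℝ} (hf : IsContracting K f) :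
    ∀ᵐ ω ∂Q, ∀ᶠ n in atTop, height f n ω < 0 := by
  filter_upwards [ae_eventually_notMem (hK.tsum_measure_ne_top hf)] with ω hω
  filter_upwards [hω] with n hn
  simpa using hn

theorem HasKernel.tendsto_measure (hK : HasKernel K Q) {f : E → ℝ} (hf : IsContracting K f) :
    Tendsto (fun n => Q.real {η | 0 ≤ height f n η}) atTop (𝓝 0) := by
  have := ENNReal.tendsto_atTop_zero_of_tsum_ne_top (hK.tsum_measure_ne_top hf)
  simpa [measureReal_def, Function.comp_def] using
    (ENNReal.tendsto_toReal ENNReal.zero_ne_top).comp this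

theorem HasKernel.exists_ascending (hK : HasKernel K Q) {h : E → ℝ} {ε : ℝ}
    (hup : ∀ n ω, ∃ e, K n ω e ≠ 0 ∧ ε ≤ h e) (n : ℕ) :
    ∃ ω : ℕ → E, Q (PiNat.cylinder ω n) ≠ 0 ∧ ∀ i < n, ε ≤ h (ω i) := by
  induction n with
  | zero =>
    obtain ⟨ω⟩ : Nonempty (ℕ → E) := nonempty_of_isProbabilityMeasure Q
    exact ⟨ω, by simp⟩
  | succ n ih =>
    obtain ⟨ω, hω, hi⟩ := ih
    obtain ⟨e, he, hεe⟩ := hup n ω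
    refine ⟨Function.update ω n e, ?_, fun i hi' => ?_⟩
    · rw [← cylinder_inter_eq, hK.measure_cylinder_inter]
      exact mul_ne_zero hω he
    · rcases Nat.lt_succ_iff_lt_or_eq.1 hi' with hlt | rfl
      · rw [Function.update_of_ne hlt.ne]
        exact hi i hlt
      · simpa using hεe

/-- Climb by at least `ε` for `n` steps along a cylinder of positive probability. From height `ε *
n`, the chance of ever dropping below `0` is at most `(1 - ρ)⁻¹ * exp (-θ * ε * n)`, which is less
than `1` for large `n`. -/
theorem HasKernel.measure_stayForever_ne_zero (hK : HasKernel K Q) {h : E → ℝ} {ε θ : ℝ}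
    (hε : 0 < ε) (hθ : 0 < θ) (hup : ∀ n ω, ∃ e, K n ω e ≠ 0 ∧ ε ≤ h e)
    (hc : IsContracting K fun e => θ * -h e) : Q (stayForever h) ≠ 0 := by
  obtain ⟨ρ, hρ1, hρ⟩ := hc
  have hfin : (1 - ρ)⁻¹ ≠ ⊤ := ENNReal.inv_ne_top.2 (tsub_pos_of_lt hρ1).ne'
  have hlim : Tendsto (fun n : ℕ => (1 - ρ)⁻¹ * ENNReal.ofReal (Real.exp (-(θ * ε) * n)))
      atTop (𝓝 0) := by
    have h1 : Tendsto (fun n : ℕ => Real.exp (-(θ * ε) * n)) atTop (𝓝 0) :=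
      Real.tendsto_exp_atBot.comp
        (tendsto_natCast_atTop_atTop.const_mul_atTop_of_neg (by nlinarith [mul_pos hθ hε]))
    have h2 := ENNReal.Tendsto.const_mul (a := (1 - ρ)⁻¹) (ENNReal.tendsto_ofReal h1)
      (Or.inr hfin)
    simpa using h2
  obtain ⟨n, hn⟩ := ((tendsto_order.1 hlim).2 1 one_pos).exists
  obtain ⟨ω, hω, hi⟩ := hK.exists_ascending hup n
  have hheight : ∀ m ≤ n, ε * m ≤ height h m ω := by
    intro m hm
    calc ε * m = ∑ i ∈ Finset.range m, ε := by simp [mul_comm]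
      _ ≤ _ := Finset.sum_le_sum fun i hi' => hi i ((Finset.mem_range.1 hi').trans_le hm)
  intro hD
  set bad : ℕ → Set (ℕ → E) := fun k =>
    PiNat.cylinder ω n ∩ {η | 0 ≤ height (fun e => θ * -h e) (n + k) η} with hbad
  have hcover : PiNat.cylinder ω n ⊆ stayForever h ∪ ⋃ k, bad k := by
    intro η hη
    by_cases hst : η ∈ stayForever h
    · exact Or.inl hst
    · simp only [stayForever, Set.mem_ofPred_eq, not_forall, not_le] at hst
      obtain ⟨m, hm⟩ := hst
      rcases le_total m n with hmn | hmn
      · rw [height_congr hη hmn] at hm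
        have := hheight m hmn
        have : 0 ≤ ε * m := by positivity
        linarith
      · obtain ⟨k, rfl⟩ := Nat.exists_eq_add_of_le hmn
        refine Or.inr (Set.mem_iUnion.2 ⟨k, hη, ?_⟩)
        rw [Set.mem_ofPred_eq, height_const_mul]
        have hneg : height (fun e => -h e) (n + k) η = -height h (n + k) η := by
          simp [height]
        rw [hneg]
        exact mul_nonneg hθ.le (by linarith)
  have hle : Q (PiNat.cylinder ω n) ≤
      (1 - ρ)⁻¹ * ENNReal.ofReal (Real.exp (-(θ * ε) * n)) * Q (PiNat.cylinder ω n) := by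
    calc Q (PiNat.cylinder ω n) ≤ Q (stayForever h) + Q (⋃ k, bad k) :=
          (measure_mono hcover).trans (measure_union_le _ _)
      _ ≤ ∑' k, Q (bad k) := by rw [hD, zero_add]; exact measure_iUnion_le _
      _ ≤ ∑' k, ρ ^ k * (ENNReal.ofReal (Real.exp (height (fun e => θ * -h e) n ω)) *
            Q (PiNat.cylinder ω n)) := ENNReal.tsum_le_tsum fun k => hK.measure_inter_le hρ n ω k
      _ = (1 - ρ)⁻¹ * ENNReal.ofReal (Real.exp (height (fun e => θ * -h e) n ω)) *
            Q (PiNat.cylinder ω n) := by rw [ENNReal.tsum_mul_right, ENNReal.tsum_geometric, mul_assoc]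
      _ ≤ _ := by
        gcongr
        have hneg : height (fun e => -h e) n ω = -height h n ω := by simp [height]
        rw [height_const_mul, hneg]
        nlinarith [hheight n le_rfl]
  refine (lt_irrefl (Q (PiNat.cylinder ω n))) (hle.trans_lt ?_)
  conv_rhs => rw [← one_mul (Q (PiNat.cylinder ω n))]
  exact ENNReal.mul_lt_mul_left hω (measure_ne_top _ _) hn

theorem height_sub_const (f : E → ℝ) (c : ℝ) (n : ℕ) (ω : ℕ → E) :
    height (fun e => f e - c) n ω = height f n ω - c * n := by
  simp [height, mul_comm]

/-- With probability at least `1 / 2` the height at time `n` exceeds `δ * n` while the excesses over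
`κ` add up to less than `δ * n / 2`. Then there are at least `δ * n / (2 * κ)` records, so their
mean number is at least `δ * n / (4 * κ)`. -/
theorem HasKernel.hasRecordDensity (hK : HasKernel K Q) {h : E → ℝ} {δ κ θ₁ θ₂ : ℝ}
    (hδ : 0 < δ) (hκ : 0 < κ) (hθ₁ : 0 < θ₁) (hθ₂ : 0 < θ₂)
    (h1 : IsContracting K fun e => θ₁ * (-h e - -δ))
    (h2 : IsContracting K fun e => θ₂ * (max (h e - κ) 0 - δ / 2)) :
    HasRecordDensity h Q := by
  have hsum := (hK.tendsto_measure h1).add (hK.tendsto_measure h2)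
  rw [add_zero] at hsum
  refine ⟨δ / (8 * κ), by positivity, ?_⟩
  -- The count runs over the times `0, …, n`, hence the shift by one; the bound `n + 1 ≤ 2 * n`
  -- costs the last factor two in `8 * κ`.
  rw [← map_add_atTop_eq_nat 1, eventually_map]
  filter_upwards [(tendsto_order.1 hsum).2 (1 / 2) (by norm_num), eventually_ge_atTop 1]
    with n hn hn1
  set S₁ : Set (ℕ → E) := {η | 0 ≤ height (fun e => θ₁ * (-h e - -δ)) n η} with hS₁
  set S₂ : Set (ℕ → E) := {η | 0 ≤ height (fun e => θ₂ * (max (h e - κ) 0 - δ / 2)) n η} with hS₂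
  have hm₁ : MeasurableSet S₁ := measurable_height _ n measurableSet_Ici
  have hm₂ : MeasurableSet S₂ := measurable_height _ n measurableSet_Ici
  have hrm : ∀ m, MeasurableSet (recordSet h m) := fun m =>
    (isPrefixEvent_recordSet h m).measurableSet
  have hgood : 1 / 2 ≤ Q.real (S₁ ∪ S₂)ᶜ := by
    rw [probReal_compl_eq_one_sub (hm₁.union hm₂)]
    linarith [measureReal_union_le (μ := Q) S₁ S₂]
  have hpoint : ∀ ω, (S₁ ∪ S₂)ᶜ.indicator (fun _ => δ / (2 * κ) * n) ω ≤
      ∑ m ∈ Finset.range (n + 1), (recordSet h m).indicator (fun _ => (1 : ℝ)) ω := by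
    intro ω
    by_cases hω : ω ∈ (S₁ ∪ S₂)ᶜ
    swap
    · rw [Set.indicator_of_notMem hω]
      exact Finset.sum_nonneg fun m _ => Set.indicator_nonneg (fun _ _ => zero_le_one) _
    rw [Set.indicator_of_mem hω]
    simp only [hS₁, hS₂, Set.compl_union, Set.mem_inter_iff, Set.mem_compl_iff,
      Set.mem_ofPred_eq, not_le] at hω
    have hneg : height (fun e => -h e) n ω = -height h n ω := by simp [height]
    rw [height_const_mul, height_const_mul, height_sub_const, height_sub_const, hneg] at hω
    have h3 : -height h n ω - -δ * n < 0 := by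
      by_contra! hc
      exact absurd hω.1 (not_lt.2 (mul_nonneg hθ₁.le hc))
    have h4 : height (fun e => max (h e - κ) 0) n ω - δ / 2 * n < 0 := by
      by_contra! hc
      exact absurd hω.2 (not_lt.2 (mul_nonneg hθ₂.le hc))
    have h5 := height_le_records h hκ.le n ω n le_rfl
    refine le_of_mul_le_mul_left ?_ hκ
    calc κ * (δ / (2 * κ) * n) = δ / 2 * n := by field_simp
      _ ≤ _ := by linarith
  have hint := integral_mono (μ := Q)
    ((integrable_const (δ / (2 * κ) * (n : ℝ))).indicator (hm₁.union hm₂).compl)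
    (integrable_finsetSum _ fun m _ => (integrable_const (1 : ℝ)).indicator (hrm m)) hpoint
  rw [integral_indicator_const _ (hm₁.union hm₂).compl,
    integral_finsetSum _ fun m _ => (integrable_const (1 : ℝ)).indicator (hrm m)] at hint
  simp only [integral_indicator_const _ (hrm _), smul_eq_mul, mul_one] at hint
  refine le_trans ?_ hint
  have hn1' : (1 : ℝ) ≤ n := by exact_mod_cast hn1
  calc δ / (8 * κ) * ((n + 1 : ℕ) : ℝ) ≤ δ / (8 * κ) * (2 * n) := by
        push_cast
        gcongr
        linarith
    _ = 1 / 2 * (δ / (2 * κ) * n) := by field_simp; norm_num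
    _ ≤ _ := by gcongr

theorem HasKernel.ae_exists_record (hK : HasKernel K Q) {h : E → ℝ} {δ θ : ℝ}
    (hδ : 0 < δ) (hθ : 0 < θ) (h1 : IsContracting K fun e => θ * (-h e - -δ)) :
    ∀ᵐ ω ∂Q, ∀ N, ∃ n ≥ N, ω ∈ recordSet h n := by
  filter_upwards [hK.ae_eventually_neg h1] with ω hω
  refine exists_record_of_tendsto (tendsto_atTop_mono' _ ?_
    (tendsto_natCast_atTop_atTop.const_mul_atTop hδ))
  filter_upwards [hω] with n hn
  have hneg : height (fun e => -h e) n ω = -height h n ω := by simp [height]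
  rw [height_const_mul, height_sub_const, hneg] at hn
  nlinarith

end Concentration

/-! ### Exponential moments of the jump laws, and limits for the law of the steps. -/

section StepLaws

instance : DiscreteMeasurableSpace Act := ⟨fun _ => trivial⟩

instance : Finite Act :=
  Finite.of_injective (fun a : Act => Act.rec true false a : Act → Bool)
    (by rintro (_ | _) (_ | _) h <;> simp_all)

instance : Nonempty Act := ⟨Act.r⟩

/-- A step of the process: an action and a jump. -/
abbrev Step := Act × Grid

variable {ν : PMF Grid} {f : Grid → ℝ} {c A B : ℝ}

/-- A bound affine in the norm covers the shifted, truncated and centred heights used below. -/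
theorem integrable_exp_mul (hc : Integrable (fun ξ : Grid => Real.exp (c * ‖toPlane ξ‖)) ν.toMeasure)
    (hf : ∀ ξ, |f ξ| ≤ A * ‖toPlane ξ‖ + B) {t : ℝ} (ht : |t| * A ≤ c) :
    Integrable (fun ξ => Real.exp (t * f ξ)) ν.toMeasure := by
  refine (hc.mul_const (Real.exp (|t| * B))).mono' (measurable_of_countable _).aestronglyMeasurable
    (ae_of_all _ fun ξ => ?_)
  rw [Real.norm_eq_abs, abs_of_pos (Real.exp_pos _), ← Real.exp_add]
  refine Real.exp_le_exp.2 ?_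
  calc t * f ξ ≤ |t| * |f ξ| := by rw [← abs_mul]; exact le_abs_self _
    _ ≤ |t| * (A * ‖toPlane ξ‖ + B) := by gcongr; exact hf ξ
    _ = |t| * A * ‖toPlane ξ‖ + |t| * B := by ring
    _ ≤ c * ‖toPlane ξ‖ + |t| * B := by gcongr

theorem zero_mem_interior_integrableExpSet (hc0 : 0 < c)
    (hc : Integrable (fun ξ : Grid => Real.exp (c * ‖toPlane ξ‖)) ν.toMeasure)
    (hf : ∀ ξ, |f ξ| ≤ A * ‖toPlane ξ‖ + B) :
    0 ∈ interior (integrableExpSet f ν.toMeasure) := by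
  rw [mem_interior_iff_mem_nhds]
  have hcont : Tendsto (fun t : ℝ => |t| * A) (𝓝 0) (𝓝 0) := by
    have : Continuous fun t : ℝ => |t| * A := by fun_prop
    simpa using this.tendsto 0
  filter_upwards [(tendsto_order.1 hcont).2 c hc0] with t ht
  exact integrable_exp_mul hc hf ht.le

theorem integrable_of_abs_le (hc0 : 0 < c)
    (hc : Integrable (fun ξ : Grid => Real.exp (c * ‖toPlane ξ‖)) ν.toMeasure)
    (hf : ∀ ξ, |f ξ| ≤ A * ‖toPlane ξ‖ + B) : Integrable f ν.toMeasure := by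
  have := integrable_pow_of_mem_interior_integrableExpSet
    (zero_mem_interior_integrableExpSet hc0 hc hf) 1
  simpa using this

/-- A function with negative mean and exponential moments has small exponential moments below
one. -/
theorem eventually_tsum_exp_lt_one (hc0 : 0 < c)
    (hc : Integrable (fun ξ : Grid => Real.exp (c * ‖toPlane ξ‖)) ν.toMeasure)
    (hf : ∀ ξ, |f ξ| ≤ A * ‖toPlane ξ‖ + B) (hneg : ∫ ξ, f ξ ∂ν.toMeasure < 0) :
    ∀ᶠ θ in 𝓝[>] (0 : ℝ), ∑' ξ, ν ξ * ENNReal.ofReal (Real.exp (θ * f ξ)) < 1 := by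
  have h0 := zero_mem_interior_integrableExpSet hc0 hc hf
  -- The moment generating function equals `1` at `0` and has the negative mean as its slope there,
  -- so it drops below `1` just to the right.
  have hderiv : HasDerivAt (mgf f ν.toMeasure) (∫ ξ, f ξ ∂ν.toMeasure) 0 := by
    simpa using hasDerivAt_mgf h0
  have hlt : ∀ᶠ θ in 𝓝[>] (0 : ℝ), mgf f ν.toMeasure θ < 1 := by
    have h1 := hderiv.hasDerivWithinAt (s := Set.Ioi 0)
    rw [hasDerivWithinAt_iff_tendsto_slope' (by simp)] at h1
    filter_upwards [(tendsto_order.1 h1).2 0 hneg, self_mem_nhdsWithin] with θ h2 hθ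
    rw [slope_def_field, mgf_zero, sub_zero, div_lt_iff₀ hθ, zero_mul] at h2
    linarith
  have hint : ∀ᶠ θ in 𝓝[>] (0 : ℝ), θ ∈ integrableExpSet f ν.toMeasure :=
    mem_nhdsWithin_of_mem_nhds (mem_interior_iff_mem_nhds.1 h0)
  filter_upwards [hlt, hint] with θ h1 h2
  have h3 : ∑' ξ, ν ξ * ENNReal.ofReal (Real.exp (θ * f ξ)) =
      ∫⁻ ξ, ENNReal.ofReal (Real.exp (θ * f ξ)) ∂ν.toMeasure := by
    rw [lintegral_countable']
    refine tsum_congr fun ξ => ?_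
    rw [PMF.toMeasure_apply_singleton _ _ (measurableSet_singleton ξ), mul_comm]
  rw [h3, ← ofReal_integral_eq_lintegral_ofReal h2 (ae_of_all _ fun ξ => (Real.exp_pos _).le)]
  rw [ENNReal.ofReal_lt_one]
  exact h1

variable {μ : Act → PMF Grid}

/-- The kernel of a process that chooses its actions by `κ` and its jumps by `μ`. -/
noncomputable def stepKernel (μ : Act → PMF Grid) (κ : ℕ → (ℕ → Step) → PMF Act) :
    ℕ → (ℕ → Step) → Step → ENNReal := fun n ω e => κ n ω e.1 * μ e.1 e.2

/-- As there are finitely many actions, one `θ` works for all of them. The kernel is a mixture over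
actions, so the largest of their moments is a bound uniform in the past, whatever the policy. -/
theorem exists_isContracting (hc0 : 0 < c)
    (hc : ∀ a, Integrable (fun ξ : Grid => Real.exp (c * ‖toPlane ξ‖)) (μ a).toMeasure)
    (κ : ℕ → (ℕ → Step) → PMF Act) {f : Step → ℝ}
    (hf : ∀ a ξ, |f (a, ξ)| ≤ A * ‖toPlane ξ‖ + B)
    (hneg : ∀ a, ∫ ξ, f (a, ξ) ∂(μ a).toMeasure < 0) :
    ∃ θ : ℝ, 0 < θ ∧ IsContracting (stepKernel μ κ) fun e => θ * f e := by
  have hev : ∀ᶠ θ in 𝓝[>] (0 : ℝ), ∀ a,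
      ∑' ξ, μ a ξ * ENNReal.ofReal (Real.exp (θ * f (a, ξ))) < 1 :=
    eventually_all.2 fun a => eventually_tsum_exp_lt_one hc0 (hc a) (hf a) (hneg a)
  obtain ⟨θ, hθ, hθ0⟩ := (hev.and self_mem_nhdsWithin).exists
  refine ⟨θ, hθ0, ⨆ a, ∑' ξ, μ a ξ * ENNReal.ofReal (Real.exp (θ * f (a, ξ))), ?_, fun n ω => ?_⟩
  · obtain ⟨a, ha⟩ := Finite.exists_max
      fun a => ∑' ξ, μ a ξ * ENNReal.ofReal (Real.exp (θ * f (a, ξ)))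
    exact (iSup_le ha).trans_lt (hθ a)
  · rw [ENNReal.tsum_prod']
    simp only [stepKernel, mul_assoc, ENNReal.tsum_mul_left]
    calc _ ≤ ∑' a, κ n ω a * ⨆ a, ∑' ξ, μ a ξ * ENNReal.ofReal (Real.exp (θ * f (a, ξ))) := by
          refine ENNReal.tsum_le_tsum fun a => ?_
          gcongr
          exact le_iSup (fun a => ∑' ξ, μ a ξ * ENNReal.ofReal (Real.exp (θ * f (a, ξ)))) a
      _ = _ := by rw [ENNReal.tsum_mul_right, PMF.tsum_coe, one_mul]

theorem abs_inner_toPlane_le (ξ : Grid) (l : Plane) :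
    |inner ℝ (toPlane ξ) l| ≤ ‖l‖ * ‖toPlane ξ‖ := by
  rw [mul_comm]
  exact abs_real_inner_le_norm _ _

theorem integrable_toPlane (hc0 : 0 < c)
    (hc : Integrable (fun ξ : Grid => Real.exp (c * ‖toPlane ξ‖)) ν.toMeasure) :
    Integrable toPlane ν.toMeasure := by
  have := integrable_of_abs_le (A := 1) (B := 0) (f := fun ξ => ‖toPlane ξ‖) hc0 hc (by simp)
  exact (integrable_norm_iff (measurable_of_countable _).aestronglyMeasurable).1 this

theorem integral_inner_toPlane (hc0 : 0 < c)
    (hc : Integrable (fun ξ : Grid => Real.exp (c * ‖toPlane ξ‖)) ν.toMeasure) (l : Plane) :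
    ∫ ξ, inner ℝ (toPlane ξ) l ∂ν.toMeasure = inner ℝ (drift ν) l := by
  rw [drift, real_inner_comm, ← integral_inner (integrable_toPlane hc0 hc)]
  simp_rw [real_inner_comm]

/-- The component of the jump in the direction `l`. -/
noncomputable def stepHeight (l : Plane) (e : Step) : ℝ := inner ℝ (toPlane e.2) l

/-- If the drifts have positive components in the direction `l`, then there is a limiting frequency
of red actions. -/
theorem exists_limit_frequency (hc0 : 0 < c)
    (hc : ∀ a, Integrable (fun ξ : Grid => Real.exp (c * ‖toPlane ξ‖)) (μ a).toMeasure)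
    {l : Plane} (hl : ∀ a, 0 < (inner ℝ (drift (μ a)) l : ℝ))
    {κ : ℕ → (ℕ → Step) → PMF Act} {Q : Measure (ℕ → Step)} [IsProbabilityMeasure Q]
    (hK : HasKernel (stepKernel μ κ) Q) (hQ : RenewsAtRecords (stepHeight l) Q)
    {f : Step → ℝ} (hf : ∀ e, f e ∈ Set.Icc 0 1) :
    ∃ α : ℝ, ∀ᵐ ω ∂Q, Tendsto (fun n : ℕ => height f n ω / n) atTop (𝓝 α) := by
  have hint : ∀ a, Integrable (fun ξ => inner ℝ (toPlane ξ) l : Grid → ℝ) (μ a).toMeasure :=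
    fun a => integrable_of_abs_le (A := ‖l‖) (B := 0) hc0 (hc a) fun ξ => by
      simpa using abs_inner_toPlane_le ξ l
  have hmean : ∀ a, ∫ ξ, (inner ℝ (toPlane ξ) l : ℝ) ∂(μ a).toMeasure = inner ℝ (drift (μ a)) l :=
    fun a => integral_inner_toPlane hc0 (hc a) l
  obtain ⟨a₀, ha₀⟩ := Finite.exists_min fun a => (inner ℝ (drift (μ a)) l : ℝ)
  obtain ⟨δ, hδ, hδl⟩ := exists_between (hl a₀)
  have hδ' : ∀ a, δ < (inner ℝ (drift (μ a)) l : ℝ) := fun a => hδl.trans_le (ha₀ a)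
  -- the height grows at a linear rate
  obtain ⟨θ₁, hθ₁, h₁⟩ := exists_isContracting (A := ‖l‖) (B := δ) hc0 hc κ
    (f := fun e => -stepHeight l e - -δ) (fun a ξ => by
      have := abs_le.1 (abs_inner_toPlane_le ξ l)
      exact abs_le.2 ⟨by simp only [stepHeight]; linarith, by simp only [stepHeight]; linarith⟩)
    (fun a => by
      simp only [stepHeight]
      simp only [neg_sub_neg]
      rw [integral_sub (integrable_const _) (hint a), hmean]
      simp only [integral_const, probReal_univ, one_smul]
      linarith [hδ' a])
  obtain ⟨θ₀, hθ₀, h₀⟩ := exists_isContracting (A := ‖l‖) (B := 0) hc0 hc κ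
    (f := fun e => -stepHeight l e) (fun a ξ => by
      simpa [stepHeight] using abs_inner_toPlane_le ξ l)
    (fun a => by
      simp only [stepHeight]
      rw [integral_neg, hmean]
      linarith [hl a])
  -- large jumps contribute little
  have htrunc : ∀ a, Tendsto (fun k : ℕ => ∫ ξ, max ((inner ℝ (toPlane ξ) l : ℝ) - k) 0
      ∂(μ a).toMeasure) atTop (𝓝 0) := by
    intro a
    have := tendsto_integral_of_dominated_convergence (μ := (μ a).toMeasure)
      (F := fun (k : ℕ) ξ => max ((inner ℝ (toPlane ξ) l : ℝ) - k) 0) (f := fun _ => (0 : ℝ))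
      (fun ξ => |(inner ℝ (toPlane ξ) l : ℝ)|)
      (fun k => (measurable_of_countable _).aestronglyMeasurable) (hint a).abs
      (fun k => ae_of_all _ fun ξ => ?_) (ae_of_all _ fun ξ => ?_)
    · simpa using this
    · rw [Real.norm_eq_abs, abs_of_nonneg (le_max_right _ _)]
      refine max_le ?_ (abs_nonneg _)
      have : (0 : ℝ) ≤ k := Nat.cast_nonneg k
      linarith [le_abs_self (inner ℝ (toPlane ξ) l : ℝ)]
    · refine tendsto_const_nhds.congr' ?_
      filter_upwards [tendsto_natCast_atTop_atTop.eventually_ge_atTop (inner ℝ (toPlane ξ) l : ℝ)]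
        with k hk
      rw [max_eq_right (by linarith)]
  obtain ⟨k, hk, hk0⟩ := ((eventually_all.2 fun a =>
    (tendsto_order.1 (htrunc a)).2 (δ / 2) (by linarith)).and (eventually_gt_atTop 0)).exists
  have hk0' : (0 : ℝ) < k := by exact_mod_cast hk0
  have hbd : ∀ ξ, |max ((inner ℝ (toPlane ξ) l : ℝ) - k) 0| ≤ ‖l‖ * ‖toPlane ξ‖ + 0 := by
    intro ξ
    have := abs_le.1 (abs_inner_toPlane_le ξ l)
    rw [abs_of_nonneg (le_max_right _ _)]
    exact max_le (by linarith) (by positivity)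
  obtain ⟨θ₂, hθ₂, h₂⟩ := exists_isContracting (A := ‖l‖) (B := δ / 2) hc0 hc κ
    (f := fun e => max (stepHeight l e - k) 0 - δ / 2) (fun a ξ => by
      refine (abs_sub _ _).trans ?_
      rw [abs_of_pos (by linarith : 0 < δ / 2)]
      have := hbd ξ
      simp only [stepHeight]
      linarith)
    (fun a => by
      simp only [stepHeight]
      rw [integral_sub (integrable_of_abs_le hc0 (hc a) hbd) (integrable_const _)]
      simp only [integral_const, probReal_univ, one_smul]
      linarith [hk a])
  -- from every site one can go up
  have hup : ∀ a, ∃ ξ, μ a ξ ≠ 0 ∧ δ ≤ inner ℝ (toPlane ξ) l := by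
    intro a
    by_contra! hcon
    have hle : ∫ ξ, (inner ℝ (toPlane ξ) l : ℝ) ∂(μ a).toMeasure ≤ ∫ _, δ ∂(μ a).toMeasure := by
      refine integral_mono_ae (hint a) (integrable_const _) ?_
      rw [EventuallyLE, ae_iff_of_countable]
      intro ξ hξ
      rw [PMF.toMeasure_apply_singleton _ _ (measurableSet_singleton ξ)] at hξ
      exact (hcon ξ hξ).le
    rw [hmean, integral_const, probReal_univ, one_smul] at hle
    linarith [hδ' a]
  refine hQ.tendsto_average (hK.hasRecordDensity hδ hk0' hθ₁ hθ₂ h₁ h₂)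
    (hK.ae_exists_record hδ hθ₁ h₁)
    (hK.measure_stayForever_ne_zero hδ hθ₀ (fun n ω => ?_) h₀) hf
  obtain ⟨a, ha⟩ := (κ n ω).support_nonempty
  obtain ⟨ξ, hξ, hδξ⟩ := hup a
  exact ⟨(a, ξ), mul_ne_zero ((PMF.mem_support_iff _ _).1 ha) hξ, hδξ⟩

/-- The jumps average to the drifts of the chosen actions. -/
theorem ae_tendsto_jump_sub_drift (hc0 : 0 < c)
    (hc : ∀ a, Integrable (fun ξ : Grid => Real.exp (c * ‖toPlane ξ‖)) (μ a).toMeasure)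
    {κ : ℕ → (ℕ → Step) → PMF Act} {Q : Measure (ℕ → Step)} [IsProbabilityMeasure Q]
    (hK : HasKernel (stepKernel μ κ) Q) (v : Plane) :
    ∀ᵐ ω ∂Q, Tendsto (fun n : ℕ =>
      height (fun e => inner ℝ (toPlane e.2 - drift (μ e.1)) v) n ω / n) atTop (𝓝 0) := by
  -- The centred jump minus `1 / (k + 1)` has negative mean under every action, so its sums are
  -- eventually negative. Applied to `v` and `-v`, this bounds the average on both sides.
  have hlow : ∀ w : Plane, ∀ᵐ ω ∂Q, ∀ k : ℕ, ∀ᶠ n : ℕ in atTop,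
      height (fun e : Step => inner ℝ (toPlane e.2 - drift (μ e.1)) w) n ω <
        1 / ((k : ℝ) + 1) * n := by
    intro w
    refine ae_all_iff.2 fun k => ?_
    have hk : (0 : ℝ) < 1 / ((k : ℝ) + 1) := by positivity
    obtain ⟨B, hB⟩ : ∃ B, ∀ a, |(inner ℝ (drift (μ a)) w : ℝ)| ≤ B := by
      obtain ⟨a, ha⟩ := Finite.exists_max fun a => |(inner ℝ (drift (μ a)) w : ℝ)|
      exact ⟨_, ha⟩
    have hint : ∀ a, Integrable (fun ξ => inner ℝ (toPlane ξ) w : Grid → ℝ) (μ a).toMeasure :=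
      fun a => integrable_of_abs_le (A := ‖w‖) (B := 0) hc0 (hc a) fun ξ => by
        simpa using abs_inner_toPlane_le ξ w
    obtain ⟨θ, hθ, h1⟩ := exists_isContracting (A := ‖w‖) (B := B + 1 / ((k : ℝ) + 1)) hc0 hc κ
      (f := fun e => inner ℝ (toPlane e.2 - drift (μ e.1)) w - 1 / ((k : ℝ) + 1)) (fun a ξ => by
        have h2 := abs_le.1 (abs_inner_toPlane_le ξ w)
        have h3 := abs_le.1 (hB a)
        simp only [inner_sub_left]
        exact abs_le.2 ⟨by linarith, by linarith⟩)
      (fun a => by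
        simp only [inner_sub_left, sub_sub]
        rw [integral_sub (hint a) (integrable_const _), integral_inner_toPlane hc0 (hc a)]
        simp only [integral_const, probReal_univ, one_smul]
        linarith)
    filter_upwards [hK.ae_eventually_neg h1] with ω hω
    filter_upwards [hω] with n hn
    rw [height_const_mul, height_sub_const] at hn
    nlinarith
  filter_upwards [hlow v, hlow (-v)] with ω h1 h2
  have hneg : ∀ n, height (fun e : Step => inner ℝ (toPlane e.2 - drift (μ e.1)) (-v)) n ω =
      -height (fun e : Step => inner ℝ (toPlane e.2 - drift (μ e.1)) v) n ω := by
    intro n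
    simp [height, inner_neg_right]
  rw [Metric.tendsto_atTop']
  intro ε hε
  obtain ⟨k, hk⟩ := exists_nat_one_div_lt hε
  obtain ⟨N, hN⟩ := eventually_atTop.1 ((h1 k).and (h2 k))
  refine ⟨N, fun n hn => ?_⟩
  obtain ⟨h3, h4⟩ := hN n hn.le
  have hn0 : (0 : ℝ) < n := by
    exact_mod_cast (Nat.zero_le N).trans_lt hn
  rw [hneg] at h4
  rw [Real.dist_eq, sub_zero, abs_div, abs_of_pos hn0, div_lt_iff₀ hn0]
  refine lt_of_lt_of_le (abs_lt.2 ⟨by linarith, h3⟩) ?_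
  gcongr

end StepLaws

/-! ### The environment as a function of the path, and its renewal at records. -/

section Environment

/-- The displacement after `n` steps. -/
def displacement (n : ℕ) (ω : ℕ → Step) : Grid := ∑ i ∈ Finset.range n, (ω i).2

open Classical in
/-- The environment after the first `n` steps of a path started at the origin. -/
noncomputable def pathEnv (β₀ : Env) (ψ : UpdateRule) : ℕ → (ℕ → Step) → Env
  | 0, _ => β₀
  | n + 1, ω => fun x a =>
    if x = displacement n ω ∧ a = (ω n).1 then
      ψ (pathEnv β₀ ψ n ω (displacement n ω)) (pathEnv β₀ ψ n ω (displacement (n + 1) ω))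
        (ω n).2 (ω n).1
    else pathEnv β₀ ψ n ω x a

/-- The law of the action at time `n`, given the first `n` steps. -/
noncomputable def pathPolicy (β₀ : Env) (ψ : UpdateRule) (φ : DecisionRule) (n : ℕ)
    (ω : ℕ → Step) : PMF Act :=
  φ (pathEnv β₀ ψ n ω (displacement n ω))

variable {β₀ : Env} {ψ : UpdateRule} {φ : DecisionRule} {l : Plane}

theorem pathEnv_succ_of_eq {n : ℕ} {ω : ℕ → Step} {x : Grid} {a : Act}
    (h : x = displacement n ω ∧ a = (ω n).1) : pathEnv β₀ ψ (n + 1) ω x a =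
      ψ (pathEnv β₀ ψ n ω (displacement n ω)) (pathEnv β₀ ψ n ω (displacement (n + 1) ω))
        (ω n).2 (ω n).1 := if_pos h

theorem pathEnv_succ_of_ne {n : ℕ} {ω : ℕ → Step} {x : Grid} {a : Act}
    (h : ¬(x = displacement n ω ∧ a = (ω n).1)) :
    pathEnv β₀ ψ (n + 1) ω x a = pathEnv β₀ ψ n ω x a := if_neg h

theorem toPlane_add (x y : Grid) : toPlane (x + y) = toPlane x + toPlane y := by
  ext i; simp [toPlane]

theorem toPlane_zero : toPlane 0 = 0 := by
  ext i; simp [toPlane]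

theorem toPlane_sum {ι : Type*} (s : Finset ι) (f : ι → Grid) :
    toPlane (∑ i ∈ s, f i) = ∑ i ∈ s, toPlane (f i) := by
  classical
  induction s using Finset.induction_on with
  | empty => simp [toPlane_zero]
  | insert a s ha ih => rw [Finset.sum_insert ha, Finset.sum_insert ha, toPlane_add, ih]

theorem height_stepHeight (n : ℕ) (ω : ℕ → Step) :
    height (stepHeight l) n ω = inner ℝ (toPlane (displacement n ω)) l := by
  rw [displacement, toPlane_sum, sum_inner]
  rfl

theorem displacement_add (n m : ℕ) (ω : ℕ → Step) :
    displacement (n + m) ω = displacement n ω + displacement m (shift n ω) := by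
  simp [displacement, shift, Finset.sum_range_add]

theorem displacement_congr {n m : ℕ} {ω η : ℕ → Step} (hη : η ∈ PiNat.cylinder ω n)
    (hm : m ≤ n) : displacement m η = displacement m ω := by
  rw [PiNat.mem_cylinder_iff] at hη
  exact Finset.sum_congr rfl fun i hi => by rw [hη i ((Finset.mem_range.1 hi).trans_le hm)]

theorem pathEnv_congr {n m : ℕ} {ω η : ℕ → Step} (hη : η ∈ PiNat.cylinder ω n) (hm : m ≤ n) :
    pathEnv β₀ ψ m η = pathEnv β₀ ψ m ω := by
  induction m with
  | zero => rfl
  | succ m ih =>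
    have h1 := PiNat.mem_cylinder_iff.1 hη m hm
    have h2 := displacement_congr hη (show m ≤ n by omega)
    ext x a
    by_cases hxa : x = displacement m ω ∧ a = (ω m).1
    · rw [pathEnv_succ_of_eq hxa, pathEnv_succ_of_eq (by rwa [h2, h1]), ih (by omega), h1, h2,
        displacement_congr hη hm]
    · rw [pathEnv_succ_of_ne hxa, pathEnv_succ_of_ne (by rwa [h2, h1]), ih (by omega)]

theorem pathEnv_of_unvisited {n : ℕ} {ω : ℕ → Step} {x : Grid}
    (hx : ∀ k < n, x ≠ displacement k ω) : pathEnv β₀ ψ n ω x = β₀ x := by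
  induction n with
  | zero => rfl
  | succ n ih =>
    ext a
    rw [pathEnv_succ_of_ne fun h => hx n (Nat.lt_succ_self n) h.1,
      ih fun k hk => hx k (by omega)]

/-- After a record, the environment above the record is the same as for a path started at it. -/
theorem pathEnv_add (hβ : ∀ x y, β₀ x = β₀ y) {n m : ℕ} {ω : ℕ → Step}
    (hr : ω ∈ recordSet (stepHeight l) n) (hs : shift n ω ∈ staySet (stepHeight l) m) {x : Grid}
    (hx : 0 ≤ (inner ℝ (toPlane x) l : ℝ)) :
    pathEnv β₀ ψ (n + m) ω (displacement n ω + x) = pathEnv β₀ ψ m (shift n ω) x := by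
  induction m generalizing x with
  | zero =>
    -- A strict record has never been reached in height before, so no site at or above its level was
    -- visited and `β₀` is still in place there.
    rw [add_zero, pathEnv_of_unvisited fun k hk heq => ?_]
    · exact hβ _ _
    · have h1 := hr k hk
      rw [height_stepHeight, height_stepHeight, ← heq, toPlane_add, inner_add_left] at h1
      linarith
  | succ m ih =>
    have hs' : shift n ω ∈ staySet (stepHeight l) m := antitone_staySet _ (Nat.le_succ m) hs
    have h1 := hs m (Nat.le_succ m)
    -- The update also reads the environment at the next state, which must be above the record too.
    have h2 := hs (m + 1) le_rfl
    rw [height_stepHeight] at h1 h2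
    ext a
    rw [← add_assoc]
    by_cases hxa : x = displacement m (shift n ω) ∧ a = (shift n ω m).1
    · rw [pathEnv_succ_of_eq hxa, pathEnv_succ_of_eq (by rwa [displacement_add, add_right_inj]),
        add_assoc, displacement_add, displacement_add, ih hs' h1, ih hs' h2]
      rfl
    · rw [pathEnv_succ_of_ne hxa, pathEnv_succ_of_ne (by rwa [displacement_add, add_right_inj]),
        ih hs' hx]

theorem pathPolicy_add (hβ : ∀ x y, β₀ x = β₀ y) {n m : ℕ} {ω : ℕ → Step}
    (hr : ω ∈ recordSet (stepHeight l) n) (hs : shift n ω ∈ staySet (stepHeight l) m) :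
    pathPolicy β₀ ψ φ (n + m) ω = pathPolicy β₀ ψ φ m (shift n ω) := by
  have h1 := hs m le_rfl
  rw [height_stepHeight] at h1
  rw [pathPolicy, displacement_add, pathEnv_add hβ hr hs h1, pathPolicy]

/-- The kernel depends on the past only through the environment at the current site, and above a
record this is the environment of the shifted path. The probabilities of the successive steps
therefore agree one by one. -/
theorem renewsAtRecords (hβ : ∀ x y, β₀ x = β₀ y) {μ : Act → PMF Grid} {Q : Measure (ℕ → Step)}
    [IsProbabilityMeasure Q] (hK : HasKernel (stepKernel μ (pathPolicy β₀ ψ φ)) Q) :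
    RenewsAtRecords (stepHeight l) Q := by
  intro n m ω hr hs
  induction m with
  | zero => simp
  | succ m ih =>
    have hs' : shift n ω ∈ staySet (stepHeight l) m := antitone_staySet _ (Nat.le_succ m) hs
    rw [← add_assoc, hK.cylinder_succ, ih hs', hK.cylinder_succ, stepKernel, stepKernel,
      pathPolicy_add hβ hr hs', mul_assoc]
    rfl

end Environment

/-! ### From the learning process to the path space and back. -/

section Transfer

set_option linter.unusedSectionVars false

variable {Ω : Type*} [mΩ : MeasurableSpace Ω] {P : Measure Ω} [IsProbabilityMeasure P]

/-- Integrate the conditional probability over an event of the past on which it is constant. -/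
theorem measure_inter_of_condExp {m : MeasurableSpace Ω} (hm : m ≤ mΩ) {C s : Set Ω}
    (hC : MeasurableSet[m] C) (hs : MeasurableSet[mΩ] s) {g : Ω → ℝ} {c : ENNReal} (hc : c ≠ ⊤)
    (h : P[s.indicator (fun _ => (1 : ℝ)) | m] =ᵐ[P] g) (hg : ∀ ω ∈ C, g ω = c.toReal) :
    P (C ∩ s) = P C * c := by
  have h1 : ∫ ω in C, (P[s.indicator (fun _ => (1 : ℝ)) | m]) ω ∂P =
      ∫ ω in C, s.indicator (fun _ => (1 : ℝ)) ω ∂P :=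
    setIntegral_condExp hm ((integrable_const (1 : ℝ)).indicator hs) hC
  have h2 : ∫ ω in C, (P[s.indicator (fun _ => (1 : ℝ)) | m]) ω ∂P = P.real C * c.toReal := by
    rw [setIntegral_congr_ae (g := fun _ => c.toReal) (hm _ hC)
      (h.mono fun ω hω hωC => by rw [hω, hg ω hωC]), setIntegral_const, smul_eq_mul]
  rw [h2, integral_indicator_const _ hs, smul_eq_mul, mul_one, measureReal_def, measureReal_def,
    Measure.restrict_apply hs, Set.inter_comm, ← ENNReal.toReal_mul] at h1
  exact ((ENNReal.toReal_eq_toReal_iff' (ENNReal.mul_ne_top (measure_ne_top _ _) hc)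
    (measure_ne_top _ _)).1 h1).symm

/-- The sequence of actions and jumps. -/
def steps (X : ℕ → Ω → Grid) (A : ℕ → Ω → Act) (ω : Ω) : ℕ → Step :=
  fun n => (A n ω, X (n + 1) ω - X n ω)

variable {p : Grid → Act → PMF Grid} {β₀ : Env} {ψ : UpdateRule} {φ : DecisionRule}
  {X : ℕ → Ω → Grid} {A : ℕ → Ω → Act} {β : ℕ → Ω → Env} {μ : Act → PMF Grid}

theorem state_eq (X : ℕ → Ω → Grid) (A : ℕ → Ω → Act) (n : ℕ) (ω : Ω) :
    X n ω = X 0 ω + displacement n (steps X A ω) := by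
  simp [displacement, steps, Finset.sum_range_sub fun i => X i ω]

/-- Seen from the initial state, the environment is a function of the steps alone, because `β₀` is
the same at every site. This removes the possibly random `X 0` from the law of the steps. -/
theorem IsLLP.env_eq (h : IsLLP P p β₀ ψ φ X A β) (n : ℕ) (ω : Ω) (x : Grid) :
    β n ω (X 0 ω + x) = pathEnv β₀ ψ n (steps X A ω) x := by
  induction n generalizing x with
  | zero =>
    rw [h.env_zero]
    exact h.env_invariant _ _
  | succ n ih =>
    ext a
    have hX := state_eq X A n ω
    by_cases hxa : x = displacement n (steps X A ω) ∧ a = A n ω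
    · obtain ⟨rfl, rfl⟩ := hxa
      have := h.env_update n ω
      rw [hX, ih, ← hX, state_eq X A (n + 1) ω, ih, ← state_eq X A (n + 1) ω] at this
      rw [pathEnv_succ_of_eq (x := displacement n (steps X A ω)) (a := A n ω) ⟨rfl, rfl⟩, ← hX, this]
      rfl
    · have hne : (X 0 ω + x, a) ≠ (X n ω, A n ω) := by
        rw [hX]
        simpa only [ne_eq, Prod.mk.injEq, add_right_inj] using hxa
      rw [h.env_keep n ω _ a hne, ih, pathEnv_succ_of_ne hxa]

theorem IsLLP.policy_eq (h : IsLLP P p β₀ ψ φ X A β) (n : ℕ) (ω : Ω) :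
    φ (β n ω (X n ω)) = pathPolicy β₀ ψ φ n (steps X A ω) := by
  rw [state_eq X A n ω, h.env_eq, pathPolicy]

theorem IsLLP.measurable_steps (h : IsLLP P p β₀ ψ φ X A β) : Measurable (steps X A) :=
  measurable_pi_lambda _ fun n =>
    (h.measurable_action n).prodMk ((h.measurable_state (n + 1)).sub (h.measurable_state n))

theorem IsLLP.historyBeforeAction_le (h : IsLLP P p β₀ ψ φ X A β) (n : ℕ) :
    historyBeforeAction X A n ≤ mΩ :=
  sup_le (iSup₂_le fun i _ => (h.measurable_state i).comap_le)
    (iSup₂_le fun i _ => (h.measurable_action i).comap_le)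

theorem IsLLP.historyAfterAction_le (h : IsLLP P p β₀ ψ φ X A β) (n : ℕ) :
    historyAfterAction X A n ≤ mΩ :=
  sup_le (iSup₂_le fun i _ => (h.measurable_state i).comap_le)
    (iSup₂_le fun i _ => (h.measurable_action i).comap_le)

theorem historyBeforeAction_le_after (n : ℕ) :
    historyBeforeAction X A n ≤ historyAfterAction X A n :=
  sup_le le_sup_left (iSup₂_le fun i hi => le_sup_of_le_right (le_iSup₂_of_le i hi.le le_rfl))

theorem measurable_state_before {n i : ℕ} (hi : i ≤ n) :
    Measurable[historyBeforeAction X A n] (X i) := by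
  rw [measurable_iff_comap_le]
  exact le_sup_of_le_left (le_iSup₂_of_le i hi le_rfl)

theorem measurable_action_before {n i : ℕ} (hi : i < n) :
    Measurable[historyBeforeAction X A n] (A i) := by
  rw [measurable_iff_comap_le]
  exact le_sup_of_le_right (le_iSup₂_of_le i hi le_rfl)

theorem measurable_action_after (n : ℕ) : Measurable[historyAfterAction X A n] (A n) := by
  rw [measurable_iff_comap_le]
  exact le_sup_of_le_right (le_iSup₂_of_le n le_rfl le_rfl)

theorem measurableSet_steps_preimage (n : ℕ) (e : ℕ → Step) :
    MeasurableSet[historyBeforeAction X A n] (steps X A ⁻¹' PiNat.cylinder e n) := by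
  have : steps X A ⁻¹' PiNat.cylinder e n =
      ⋂ i, ⋂ (_ : i < n), (fun ω => (A i ω, X (i + 1) ω - X i ω)) ⁻¹' {e i} := by
    ext ω
    simp [PiNat.mem_cylinder_iff, steps]
  rw [this]
  refine MeasurableSet.iInter fun i => MeasurableSet.iInter fun hi => ?_
  exact ((measurable_action_before hi).prodMk
    ((measurable_state_before (Nat.succ_le_of_lt hi)).sub (measurable_state_before hi.le)))
    (measurableSet_singleton _)

/-- The law of the steps of a local learning process with translation invariant transitions. -/
theorem IsLLP.hasKernel (h : IsLLP P p β₀ ψ φ X A β)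
    (hp : ∀ (x ξ : Grid) (a : Act), p x a (x + ξ) = μ a ξ) :
    HasKernel (stepKernel μ (pathPolicy β₀ ψ φ)) (P.map (steps X A)) where
  congr := by
    intro n ω η hη
    funext e
    rw [stepKernel, stepKernel, pathPolicy, pathPolicy, pathEnv_congr hη le_rfl,
      displacement_congr hη le_rfl]
  cylinder_succ := by
    intro n e
    rw [Measure.map_apply h.measurable_steps (isPrefixEvent_cylinder e n).measurableSet,
      Measure.map_apply h.measurable_steps (isPrefixEvent_cylinder e (n + 1)).measurableSet]
    set C := steps X A ⁻¹' PiNat.cylinder e n with hC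
    have hCm := measurableSet_steps_preimage (X := X) (A := A) n e
    have hAm : MeasurableSet {ω | A n ω = (e n).1} :=
      h.measurable_action n (measurableSet_singleton _)
    have h1 : P (C ∩ {ω | A n ω = (e n).1}) = P C * pathPolicy β₀ ψ φ n e (e n).1 := by
      refine measure_inter_of_condExp (h.historyBeforeAction_le n) hCm hAm (PMF.apply_ne_top _ _)
        (h.action_law n (e n).1) fun ω hω => ?_
      rw [h.policy_eq, pathPolicy, pathPolicy, pathEnv_congr hω le_rfl,
        displacement_congr hω le_rfl]
    set C' := C ∩ {ω | A n ω = (e n).1} with hC'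
    have hC'm : MeasurableSet[historyAfterAction X A n] C' :=
      (historyBeforeAction_le_after n _ hCm).inter
        (measurable_action_after n (measurableSet_singleton _))
    -- The law of the next state concerns a fixed target, whereas a cylinder fixes the jump. The
    -- event is therefore split over the countably many values of `X n`.
    have hXm : ∀ x, MeasurableSet[historyAfterAction X A n] (C' ∩ {ω | X n ω = x}) := fun x =>
      hC'm.inter (historyBeforeAction_le_after n _
        (measurable_state_before le_rfl (measurableSet_singleton x)))
    have h2 : ∀ x, P (C' ∩ {ω | X n ω = x} ∩ {ω | X (n + 1) ω = x + (e n).2}) =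
        P (C' ∩ {ω | X n ω = x}) * μ (e n).1 (e n).2 := by
      intro x
      refine measure_inter_of_condExp (h.historyAfterAction_le n) (hXm x)
        (h.measurable_state (n + 1) (measurableSet_singleton _)) (PMF.apply_ne_top _ _)
        (h.state_law n (x + (e n).2)) fun ω hω => ?_
      rw [show X n ω = x from hω.2, show A n ω = (e n).1 from hω.1.2, hp]
    have hdisj : Pairwise (Function.onFun Disjoint fun x => {ω | X n ω = x}) := by
      intro x y hxy
      rw [Function.onFun, Set.disjoint_left]
      rintro ω rfl hy
      exact hxy hy
    have hsplit : ∀ S : Set Ω, MeasurableSet S → P S = ∑' x, P (S ∩ {ω | X n ω = x}) := by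
      intro S hS
      rw [← measure_iUnion (fun x y hxy => (hdisj hxy).mono Set.inter_subset_right
        Set.inter_subset_right) fun x => hS.inter (h.measurable_state n (measurableSet_singleton x)),
        ← Set.inter_iUnion]
      congr 1
      ext ω
      simp
    have h3 : steps X A ⁻¹' PiNat.cylinder e (n + 1) =
        C' ∩ {ω | X (n + 1) ω - X n ω = (e n).2} := by
      ext ω
      simp only [hC', hC, Set.mem_preimage, PiNat.mem_cylinder_iff, Set.mem_inter_iff,
        Set.mem_ofPred_eq, Nat.forall_lt_succ_right, steps, Prod.ext_iff]
      tauto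
    have hjump : MeasurableSet {ω | X (n + 1) ω - X n ω = (e n).2} :=
      ((h.measurable_state (n + 1)).sub (h.measurable_state n)) (measurableSet_singleton _)
    rw [h3, hsplit _ ((h.historyAfterAction_le n _ hC'm).inter hjump),
      stepKernel, ← mul_assoc, ← h1, hsplit _ (h.historyAfterAction_le n _ hC'm),
      ← ENNReal.tsum_mul_right]
    refine tsum_congr fun x => ?_
    rw [← h2]
    congr 1
    ext ω
    simp only [Set.mem_inter_iff, Set.mem_ofPred_eq]
    constructor
    · rintro ⟨⟨h4, h5⟩, h6⟩
      exact ⟨⟨h4, h6⟩, by rw [← h5, ← h6]; abel⟩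
    · rintro ⟨⟨h4, h6⟩, h5⟩
      exact ⟨⟨h4, by rw [h5, h6]; abel⟩, h6⟩

/-- The frequency of red actions determines the limiting velocity. -/
theorem tendsto_velocity {ω : Ω} {α : ℝ} (hα : Tendsto (fun n : ℕ =>
      height (fun e : Step => ({Act.r} : Set Act).indicator (fun _ => (1 : ℝ)) e.1) n
        (steps X A ω) / n) atTop (𝓝 α))
    (hv : ∀ j, Tendsto (fun n : ℕ => height (fun e : Step => inner ℝ (toPlane e.2 - drift (μ e.1))
      (EuclideanSpace.basisFun (Fin 2) ℝ j)) n (steps X A ω) / n) atTop (𝓝 0)) :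
    Tendsto (fun n : ℕ => (1 / (n : ℝ)) • toPlane (X n ω)) atTop
      (𝓝 (α • drift (μ Act.r) + (1 - α) • drift (μ Act.g))) := by
  set b := EuclideanSpace.basisFun (Fin 2) ℝ
  set S : ℕ → ℝ := fun n => height (fun e : Step =>
    ({Act.r} : Set Act).indicator (fun _ => (1 : ℝ)) e.1) n (steps X A ω) with hS
  -- The position is the initial state, plus this sum of centred jumps, plus the drifts of the
  -- chosen actions. The centred part is negligible by its two coordinates, and the drift part
  -- depends only on the number `S n` of red actions.
  set M : ℕ → Plane := fun n => ∑ i ∈ Finset.range n,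
    (toPlane (steps X A ω i).2 - drift (μ (steps X A ω i).1)) with hM
  have hMlim : Tendsto (fun n : ℕ => (1 / (n : ℝ)) • M n) atTop (𝓝 0) := by
    have h1 : Tendsto (fun n : ℕ => ∑ j, (height (fun e : Step =>
        inner ℝ (toPlane e.2 - drift (μ e.1)) (b j)) n (steps X A ω) / n) • b j) atTop
        (𝓝 (∑ j, (0 : ℝ) • b j)) :=
      tendsto_finsetSum _ fun j _ => (hv j).smul_const (b j)
    simp only [zero_smul, Finset.sum_const_zero] at h1
    refine h1.congr fun n => ?_
    rw [← b.sum_repr' (M n), Finset.smul_sum]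
    refine Finset.sum_congr rfl fun j _ => ?_
    rw [smul_smul, real_inner_comm, hM, sum_inner, height]
    congr 1
    ring
  have hdrift : ∀ n : ℕ, ∑ i ∈ Finset.range n, drift (μ (steps X A ω i).1) =
      S n • drift (μ Act.r) + ((n : ℝ) - S n) • drift (μ Act.g) := by
    intro n
    induction n with
    | zero => simp [hS]
    | succ n ih =>
      have hsucc : S (n + 1) = S n + ({Act.r} : Set Act).indicator (fun _ => (1 : ℝ))
        (steps X A ω n).1 := height_succ _ _ _
      rw [Finset.sum_range_succ, ih, hsucc]
      rcases (steps X A ω n).1 with _ | _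
      · simp only [Set.mem_singleton_iff, Set.indicator_of_mem]
        push_cast
        module
      · simp only [Set.mem_singleton_iff, reduceCtorEq, not_false_eq_true,
          Set.indicator_of_notMem]
        push_cast
        module
  have hdecomp : ∀ n : ℕ, toPlane (X n ω) = toPlane (X 0 ω) + M n +
      (S n • drift (μ Act.r) + ((n : ℝ) - S n) • drift (μ Act.g)) := by
    intro n
    rw [← hdrift, state_eq X A n ω, toPlane_add, displacement, toPlane_sum, hM]
    simp only [Finset.sum_sub_distrib]
    abel
  have h0 : Tendsto (fun n : ℕ => (1 / (n : ℝ)) • toPlane (X 0 ω)) atTop (𝓝 0) := by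
    simpa using (tendsto_one_div_atTop_nhds_zero_nat (𝕜 := ℝ)).smul_const (toPlane (X 0 ω))
  have hα' : Tendsto (fun n : ℕ => S n / n) atTop (𝓝 α) := hα
  have hlim := (h0.add hMlim).add ((hα'.smul_const (drift (μ Act.r))).add
    ((hα'.const_sub 1).smul_const (drift (μ Act.g))))
  rw [add_zero, zero_add] at hlim
  refine hlim.congr' ?_
  filter_upwards [eventually_gt_atTop 0] with n hn
  have hn' : (n : ℝ) ≠ 0 := by positivity
  have h1 : S n / n = 1 / (n : ℝ) * S n := by ring
  have h2 : 1 - S n / n = 1 / (n : ℝ) * (n - S n) := by field_simp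
  rw [hdecomp n, smul_add, smul_add, smul_add, smul_smul, smul_smul, h2, h1]

/-- The actions counted are those at times `1, …, n`, while paths start with the action at time `0`;
this accounts for the extra step and the subtracted term. -/
theorem sum_Icc_eq_height (f : Act → ℝ) (n : ℕ) (ω : Ω) :
    ∑ i ∈ Finset.Icc 1 n, f (A i ω) =
      height (fun e : Step => f e.1) (n + 1) (steps X A ω) - f (A 0 ω) := by
  induction n with
  | zero => simp [height, steps]
  | succ n ih =>
    rw [Finset.sum_Icc_succ_top (by omega), ih, height_succ _ (n + 1)]
    simp only [steps]
    ring

theorem tendsto_average_Icc {f : Act → ℝ} {ω : Ω} {α : ℝ} (hα : Tendsto (fun n : ℕ =>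
      height (fun e : Step => f e.1) n (steps X A ω) / n) atTop (𝓝 α)) :
    Tendsto (fun n : ℕ => (1 / (n : ℝ)) * ∑ i ∈ Finset.Icc 1 n, f (A i ω)) atTop (𝓝 α) := by
  have h1 := hα.comp (tendsto_add_atTop_nat 1)
  have h2 : Tendsto (fun n : ℕ => 1 + 1 / (n : ℝ)) atTop (𝓝 1) := by
    simpa using tendsto_one_div_atTop_nhds_zero_nat.const_add (1 : ℝ)
  have h3 := (h1.mul h2).sub (tendsto_const_div_atTop_nhds_zero_nat (f (A 0 ω)))
  rw [mul_one, sub_zero] at h3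
  refine h3.congr' ?_
  filter_upwards [eventually_gt_atTop 0] with n hn
  have hn' : (n : ℝ) ≠ 0 := by positivity
  have hn1 : (n : ℝ) + 1 ≠ 0 := by positivity
  rw [sum_Icc_eq_height]
  simp only [Function.comp_apply, Nat.cast_add, Nat.cast_one]
  field_simp

end Transfer

end LocalLearning

theorem mainTheorem2 {Ω : Type*} [MeasurableSpace Ω] (P : Measure Ω) [IsProbabilityMeasure P]
    (p : LocalLearning.Grid → LocalLearning.Act → PMF LocalLearning.Grid)
    (μ : LocalLearning.Act → PMF LocalLearning.Grid)
    (hmodel : LocalLearning.IsFreeModel p μ)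
    (β₀ : LocalLearning.Env) (ψ : LocalLearning.UpdateRule) (φ : LocalLearning.DecisionRule)
    (X : ℕ → Ω → LocalLearning.Grid) (A : ℕ → Ω → LocalLearning.Act)
    (β : ℕ → Ω → LocalLearning.Env)
    (hLLP : LocalLearning.IsLLP P p β₀ ψ φ X A β) :
    ∃ α : ℝ,
      (∀ᵐ ω ∂P, Tendsto (fun n : ℕ => (1 / (n : ℝ)) *
          ∑ i ∈ Finset.Icc 1 n, ({LocalLearning.Act.r} : Set LocalLearning.Act).indicator
            (fun _ => (1 : ℝ)) (A i ω)) atTop (𝓝 α)) ∧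
      (∀ᵐ ω ∂P, Tendsto (fun n : ℕ => (1 / (n : ℝ)) • LocalLearning.toPlane (X n ω)) atTop
        (𝓝 (α • LocalLearning.drift (μ LocalLearning.Act.r) +
          (1 - α) • LocalLearning.drift (μ LocalLearning.Act.g)))) := by
  open LocalLearning in
  obtain ⟨c, hc0, hc⟩ := hmodel.exp_moment
  obtain ⟨l, -, hl⟩ := hmodel.common_direction
  have hl' : ∀ a, 0 < (inner ℝ (drift (μ a)) l : ℝ) := by
    rintro (_ | _)
    · exact (lt_min_iff.1 hl).1
    · exact (lt_min_iff.1 hl).2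
  have hK := hLLP.hasKernel hmodel.transition
  have hsteps := hLLP.measurable_steps
  have := Measure.isProbabilityMeasure_map (μ := P) hsteps.aemeasurable
  -- Both limits are almost sure statements about the law of the steps, and are pulled back along
  -- `steps X A`.
  obtain ⟨α, hα⟩ := exists_limit_frequency hc0 hc hl' hK
    (renewsAtRecords hLLP.env_invariant hK)
    (f := fun e => ({Act.r} : Set Act).indicator (fun _ => (1 : ℝ)) e.1) fun e =>
      ⟨Set.indicator_nonneg (fun _ _ => zero_le_one) _,
        Set.indicator_le_self' (fun _ _ => zero_le_one) _⟩
  have hα' := ae_of_ae_map hsteps.aemeasurable hα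
  have hv := ae_of_ae_map hsteps.aemeasurable (ae_all_iff.2 fun j =>
    ae_tendsto_jump_sub_drift hc0 hc hK (EuclideanSpace.basisFun (Fin 2) ℝ j))
  refine ⟨α, ?_, ?_⟩
  · filter_upwards [hα'] with ω hω
    exact tendsto_average_Icc hω
  · filter_upwards [hα', hv] with ω hω hω'
    exact tendsto_velocity hω hω'
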